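/- Let $(\mathbf X,\mathcal B(\mathbf X))$ be a standard Borel space, $T_0\in\mathbb R$ and $T_0<T_1\le+\infty$. Let $q(x,t,B)$, $x\in\mathbf X$, $t\in[T_0,T_1[$, $B\in\mathcal B(\mathbf X)$, be a conservative $Q$-function: for all $x,t$, $q(x,t,\cdot)$ is a finite signed measure on $\mathbf X$ with $q(x,t,\mathbf X)=0$ and $q(x,t,B\setminus\{x\})\ge 0$ for all $B\in\mathcal B(\mathbf X)$, and for all $B\in\mathcal B(\mathbf X)$ the function $q(x,t,B)$ is measurable in $(x,t)$. Put $q(x,t):=q(x,t,\mathbf X\setminus\{x\})$ and assume that $$\sup_{t\in[T_0,s[}q(x,t)<\infty\qquad\text{for all } s\in\,]T_0,T_1[\text{ and } x\in\mathbf X .$$ For $u\in[T_0,T_1[$, $t\in\,]u,T_1[$, $x\in\mathbf X$, $B\in\mathcal B(\mathbf X)$ define $\bar P(u,x;t,B):=\sum_{n=0}^\infty \bar P^{(n)}(u,x;t,B)$, where $$\bar P^{(0)}(u,x;t,B):=\mathbf I\{x\in B\}\,e^{-\int_u^t q(x,s)\,ds},$$ $$\bar P^{(n)}(u,x;t,B):=\int_u^t\int_{\mathbf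 X}e^{-\int_u^w q(x,\theta)\,d\theta}\,\bar P^{(n-1)}(w,y;t,B)\,q(x,w,dy\setminus\{x\})\,dw,\qquad n\ge 1,$$ and $q(x,w,dy\setminus\{x\})$ denotes the measure $B\mapsto q(x,w,B\setminus\{x\})$. For $s\in\,]T_0,T_1[$, a set $B\in\mathcal B(\mathbf X)$ is called $(q,s)$-bounded if $q(x,t)$ is bounded on $B\times[T_0,s[$. Let $\hat{\mathcal P}$ be the family of all real-valued functions $P(u,x;t,B)$, defined for $u\in[T_0,T_1[$, $t\in\,]u,T_1[$, $x\in\mathbf X$, $B\in\mathcal B(\mathbf X)$, that are (nonnegative) measures in $B$ for fixed $u,x,t$ and measurable in $t\in\,]u,T_1[$ for fixed $u,x,B$. Then $\bar P$ belongs to $\hat{\mathcal P}$ and satisfies the following two properties for all $u\in[T_0,T_1[$, $s\in\,]u,T_1[$, $x\in\mathbf X$ and all $(q,s)$-bounded sets $B$ (with $P=\bar P$): (i) $\lim_{t\to u+}P(u,x;t,B)=\mathbf I\{x\in B\}$, and $P(u,x;t,B)$ is absolutely continuous in $t\in\,]u,s[$; (ii) for almost every $t\in\,]u,s[$, Kolmogorov's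 forward equation $$\frac{\partial}{\partial t}P(u,x;t,B)=-\int_B q(y,t)\,P(u,x;t,dy)+\int_{\mathbf X}q(y,t,B\setminus\{y\})\,P(u,x;t,dy)$$ holds, the derivative existing and both integrals on the right being finite. Moreover, $\bar P$ is the minimal function in $\hat{\mathcal P}$ with properties (i) and (ii): every $P\in\hat{\mathcal P}$ with these properties satisfies $\bar P(u,x;t,B)\le P(u,x;t,B)$ for all $u\in[T_0,T_1[$, $t\in\,]u,T_1[$, $x\in\mathbf X$, $B\in\mathcal B(\mathbf X)$. If in addition $\bar P$ is regular, that is, $\bar P(u,x;t,\mathbf X)=1$ for all $u\in[T_0,T_1[$, $t\in\,]u,T_1[$, $x\in\mathbf X$, then $\bar P$ is the unique function in $\hat{\mathcal P}$ that satisfies (i) and (ii) and takes values in $[0,1]$. -/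

import Mathlib

open MeasureTheory Set Filter Topology
open scoped ENNReal

namespace JumpMarkov

noncomputable section

/-- The time interval `[T₀, T₁[`, with `T₀` real and `T₁` possibly `+∞`. -/
def timeSet (T₀ : ℝ) (T₁ : EReal) : Set ℝ := {t | T₀ ≤ t ∧ (t : EReal) < T₁}

/-- The times `t ∈ ]u, T₁[`. -/
def timeAfter (u : ℝ) (T₁ : EReal) : Set ℝ := {t | u < t ∧ (t : EReal) < T₁}

/-- A conservative `Q`-function `q(x, t, B)` on `X × [T₀, T₁[`: each `q x t` is a (finite) signed
measure with `0 ≤ q(x, t, B \ {x})` and `q(x, t, X) = 0`, and `(x, t) ↦ q(x, t, B)` is measurable on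
`X × [T₀, T₁[`. The values of `q x t` for `t` outside `[T₀, T₁[` are irrelevant. -/
structure IsConservativeQFunction {X : Type*} [MeasurableSpace X] (T₀ : ℝ) (T₁ : EReal)
    (q : X → ℝ → SignedMeasure X) : Prop where
  nonneg_off : ∀ x, ∀ t ∈ timeSet T₀ T₁, ∀ B, MeasurableSet B → 0 ≤ q x t (B \ {x})
  univ_eq_zero : ∀ x, ∀ t ∈ timeSet T₀ T₁, q x t univ = 0
  measurable_eval : ∀ B, MeasurableSet B →
    Measurable (fun p : X × timeSet T₀ T₁ => q p.1 (p.2 : ℝ) B)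

/-- The jump rate `q(x, t) = q(x, t, X \ {x})`. -/
def rate {X : Type*} [MeasurableSpace X] (q : X → ℝ → SignedMeasure X) (x : X) (t : ℝ) : ℝ :=
  q x t (univ \ {x})

open Classical in
/-- The measure `q⁺(x, t, B) = q(x, t, B \ {x})`. For a `Q`-function and `t ∈ [T₀, T₁[` the first
branch applies. -/
def jumpMeasure {X : Type*} [MeasurableSpace X] [MeasurableSingletonClass X]
    (q : X → ℝ → SignedMeasure X) (x : X) (t : ℝ) : Measure X :=
  if h : VectorMeasure.restrict 0 ({x}ᶜ : Set X) ≤ (q x t).restrict {x}ᶜ then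
    (q x t).toMeasureOfZeroLE {x}ᶜ (measurableSet_singleton x).compl h
  else 0

/-- On a measurable set, `jumpMeasure` is indeed `q(x, t, B \ {x})`. -/
theorem jumpMeasure_apply {X : Type*} [MeasurableSpace X] [MeasurableSingletonClass X]
    {T₀ : ℝ} {T₁ : EReal} {q : X → ℝ → SignedMeasure X} (hq : IsConservativeQFunction T₀ T₁ q)
    (x : X) {t : ℝ} (ht : t ∈ timeSet T₀ T₁) {B : Set X} (hB : MeasurableSet B) :
    jumpMeasure q x t B = ENNReal.ofReal (q x t (B \ {x})) := by
  have hx : MeasurableSet ({x}ᶜ : Set X) := (measurableSet_singleton x).compl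
  have h : VectorMeasure.restrict 0 ({x}ᶜ : Set X) ≤ (q x t).restrict {x}ᶜ := by
    refine VectorMeasure.restrict_le_restrict_of_subset_le _ _ (fun {j} hj hjs => ?_)
    have h0 := hq.nonneg_off x t ht j hj
    have hd : j \ {x} = j := by
      ext y
      simp only [Set.mem_sdiff, mem_singleton_iff, and_iff_left_iff_imp]
      exact fun hy => hjs hy
    rw [hd] at h0
    simpa using h0
  have hset : ({x}ᶜ : Set X) ∩ B = B \ {x} := by
    rw [inter_comm, Set.sdiff_eq]
  rw [jumpMeasure, dif_pos h, SignedMeasure.toMeasureOfZeroLE_apply _ h hx hB,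
    ← ENNReal.ofReal_coe_nnreal]
  simp only [NNReal.coe_mk, hset]

/-- Local boundedness of the jump rates:
`sup_{t ∈ [T₀, s[} q(x, t) < ∞` for all `s ∈ ]T₀, T₁[` and `x ∈ X`. -/
def LocallyBoundedRates {X : Type*} [MeasurableSpace X] (T₀ : ℝ) (T₁ : EReal)
    (q : X → ℝ → SignedMeasure X) : Prop :=
  ∀ s ∈ timeAfter T₀ T₁, ∀ x, BddAbove ((fun t => rate q x t) '' Ico T₀ s)

/-- A measurable set `B` is `(q, s)`-bounded if `q(x, t)` is bounded on `B × [T₀, s[`. -/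
def IsQBounded {X : Type*} [MeasurableSpace X] (T₀ : ℝ) (q : X → ℝ → SignedMeasure X)
    (s : ℝ) (B : Set X) : Prop :=
  MeasurableSet B ∧ ∃ C : ℝ, ∀ x ∈ B, ∀ t ∈ Ico T₀ s, |rate q x t| ≤ C

/-- Feller's iterates `P̄⁽ⁿ⁾(u, x; t, B)`. -/
def fellerIter {X : Type*} [MeasurableSpace X] [MeasurableSingletonClass X]
    (q : X → ℝ → SignedMeasure X) : ℕ → ℝ → X → ℝ → Set X → ℝ≥0∞
  | 0, u, x, t, B =>
      B.indicator (fun _ => ENNReal.ofReal (Real.exp (-∫ s in u..t, rate q x s))) x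
  | n + 1, u, x, t, B =>
      ∫⁻ w in Ioo u t, ∫⁻ y,
        ENNReal.ofReal (Real.exp (-∫ θ in u..w, rate q x θ)) * fellerIter q n w y t B
          ∂(jumpMeasure q x w)

/-- Feller's function `P̄(u, x; t, B) = ∑ₙ P̄⁽ⁿ⁾(u, x; t, B)`. -/
def feller {X : Type*} [MeasurableSpace X] [MeasurableSingletonClass X]
    (q : X → ℝ → SignedMeasure X) (u : ℝ) (x : X) (t : ℝ) (B : Set X) : ℝ≥0∞ :=
  ∑' n, fellerIter q n u x t B

/-- The family `𝒫̂` of real-valued functions `P(u, x; t, B)`, `u ∈ [T₀, T₁[`, `t ∈ ]u, T₁[`, that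
are (hence finite) measures in `B` and are measurable in `t ∈ ]u, T₁[`. The values of `P u x t`
for other `u`, `t` are irrelevant. -/
structure InPHat {X : Type*} [MeasurableSpace X] (T₀ : ℝ) (T₁ : EReal)
    (P : ℝ → X → ℝ → Measure X) : Prop where
  finite : ∀ u ∈ timeSet T₀ T₁, ∀ x, ∀ t ∈ timeAfter u T₁, IsFiniteMeasure (P u x t)
  measurable_time : ∀ u ∈ timeSet T₀ T₁, ∀ x, ∀ B, MeasurableSet B →
    Measurable (fun t : timeAfter u T₁ => P u x (t : ℝ) B)

/-- Absolute continuity of `f` on the open interval `]u, s[` (the `ε`-`δ` definition). -/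
def AbsContOnIoo (f : ℝ → ℝ) (u s : ℝ) : Prop :=
  ∀ ε > 0, ∃ δ > 0, ∀ (n : ℕ) (a b : ℕ → ℝ),
    (∀ i < n, u < a i ∧ a i ≤ b i ∧ b i < s) →
    (∀ i < n, ∀ j < n, i ≠ j → Disjoint (Ioo (a i) (b i)) (Ioo (a j) (b j))) →
    ∑ i ∈ Finset.range n, (b i - a i) < δ →
    ∑ i ∈ Finset.range n, |f (b i) - f (a i)| < ε

/-- Property (i): for every `(q, s)`-bounded `B`, `P(u, x; t, B) → 1_B(x)` as `t → u+`, and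
`t ↦ P(u, x; t, B)` is absolutely continuous on `]u, s[`. -/
def BoundaryAndAC {X : Type*} [MeasurableSpace X] (T₀ : ℝ) (T₁ : EReal)
    (q : X → ℝ → SignedMeasure X) (P : ℝ → X → ℝ → Measure X) : Prop :=
  ∀ u ∈ timeSet T₀ T₁, ∀ s ∈ timeAfter u T₁, ∀ x, ∀ B, IsQBounded T₀ q s B →
    Tendsto (fun t => (P u x t).real B) (𝓝[>] u) (𝓝 (B.indicator (fun _ => (1 : ℝ)) x)) ∧
    AbsContOnIoo (fun t => (P u x t).real B) u s

/-- Kolmogorov's forward equation for `μ_t = P(u, x; t, ·)` and the set `B` at time `t`: both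
integrals on the right-hand side are finite, and
`∂/∂t P(u, x; t, B) = -∫_B q(y, t) P(u, x; t, dy) + ∫_X q(y, t, B \ {y}) P(u, x; t, dy)`. -/
def ForwardEquationAt {X : Type*} [MeasurableSpace X]
    (q : X → ℝ → SignedMeasure X) (μ : ℝ → Measure X) (B : Set X) (t : ℝ) : Prop :=
  IntegrableOn (fun y => rate q y t) B (μ t) ∧
  Integrable (fun y => q y t (B \ {y})) (μ t) ∧
  HasDerivAt (fun r => (μ r).real B)
    (-(∫ y in B, rate q y t ∂(μ t)) + ∫ y, q y t (B \ {y}) ∂(μ t)) t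

/-- Property (ii): for every `(q, s)`-bounded `B`, the forward equation holds for almost every
`t ∈ ]u, s[`. -/
def ForwardEquation {X : Type*} [MeasurableSpace X] (T₀ : ℝ) (T₁ : EReal)
    (q : X → ℝ → SignedMeasure X) (P : ℝ → X → ℝ → Measure X) : Prop :=
  ∀ u ∈ timeSet T₀ T₁, ∀ s ∈ timeAfter u T₁, ∀ x, ∀ B, IsQBounded T₀ q s B →
    ∀ᵐ t ∂(volume.restrict (Ioo u s)), ForwardEquationAt q (P u x) B t

/-- The functions in `𝒫̂` with properties (i) and (ii). -/
structure IsForwardSolution {X : Type*} [MeasurableSpace X] (T₀ : ℝ) (T₁ : EReal)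
    (q : X → ℝ → SignedMeasure X) (P : ℝ → X → ℝ → Measure X) : Prop where
  mem : InPHat T₀ T₁ P
  boundary : BoundaryAndAC T₀ T₁ q P
  forward : ForwardEquation T₀ T₁ q P

/-- `P` takes values in `[0, 1]`. -/
def UnitValued {X : Type*} [MeasurableSpace X] (T₀ : ℝ) (T₁ : EReal)
    (P : ℝ → X → ℝ → Measure X) : Prop :=
  ∀ u ∈ timeSet T₀ T₁, ∀ x, ∀ t ∈ timeAfter u T₁, ∀ B, MeasurableSet B → P u x t B ≤ 1

/-- `P` is regular: `P(u, x; t, X) = 1` for all `u, x, t` in its domain. -/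
def IsRegular {X : Type*} [MeasurableSpace X] (T₀ : ℝ) (T₁ : EReal)
    (P : ℝ → X → ℝ → Measure X) : Prop :=
  ∀ u ∈ timeSet T₀ T₁, ∀ x, ∀ t ∈ timeAfter u T₁, P u x t univ = 1

end

end JumpMarkov

namespace JumpMarkov

open ProbabilityTheory

/-! ### Survival probabilities and time integrals. -/

section

/-! The forward equation is compared with two integral forms. Integrating it in time over a `(q,
s)`-bounded set gives a balance (`IsBalanced`): present mass plus mass lost to jumps out equals
initial mass plus mass gained from jumps in. Duhamel's formula gives a mild form (`IsMild`): the
mass in a set is the initial mass, and the mass that arrived by jumps, weighted by the probability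
of not having jumped since. The two are tied together by Tonelli's theorem and the fact that a
particle either jumps before a given time or survives to it (`IsMild.balanced`,
`mild_of_balanced_subsets`). Working in `ℝ≥0∞` leaves one subtraction, and that one needs finite
outflow.

Existence. Feller's iterates are defined by the first jump, but also satisfy a recursion on the last
jump (`lintegral_fellerKernel_succ_forward`). Summing that recursion shows that Feller's function is
mild, hence balanced. On a bounded set the outflow is integrable, so the balance makes the inflow
integrable too, and Lebesgue differentiation yields (i) and (ii).

Minimality. A solution of (i) and (ii) is balanced on bounded sets, hence mild on them. Countably
many bounded sets cover the space (`exists_isQBounded_cover`), so it is mild on every measurable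
set. Since a boundedness condition ranges over uncountably many times, this cover is obtained from
Novikov's separation theorem for analytic sets. Iterating the mild equation puts every partial sum
of Feller's series below the solution (`minimalFrom_le_of_isMild`).

Uniqueness. In the regular case the minimal solution has mass one, so a solution with values in `[0,
1]` that dominates it has the same finite total mass and must coincide with it. -/

theorem _root_.AbsolutelyContinuousOnInterval.lipschitzOnWith_comp {f φ : ℝ → ℝ} {a b : ℝ}
    {K : NNReal} {s : Set ℝ} (hφ : LipschitzOnWith K φ s) (hs : MapsTo f (uIcc a b) s)
    (hf : AbsolutelyContinuousOnInterval f a b) :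
    AbsolutelyContinuousOnInterval (φ ∘ f) a b := by
  have h0 : Tendsto (fun E : ℕ × (ℕ → ℝ × ℝ) =>
      (K : ℝ) * ∑ i ∈ Finset.range E.1, dist (f (E.2 i).1) (f (E.2 i).2))
      (AbsolutelyContinuousOnInterval.totalLengthFilter ⊓
        𝓟 (AbsolutelyContinuousOnInterval.disjWithin a b)) (𝓝 0) := by
    simpa using Tendsto.const_mul (K : ℝ) hf
  refine squeeze_zero' (Eventually.of_forall fun E => Finset.sum_nonneg fun i _ => dist_nonneg)
    ?_ h0
  filter_upwards [mem_inf_of_right (mem_principal_self _)] with E hE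
  rw [Finset.mul_sum]
  refine Finset.sum_le_sum fun i hi => ?_
  exact hφ.dist_le_mul _ (hs (hE.1 i hi).1) _ (hs (hE.1 i hi).2)

theorem lipschitzOnWith_exp_Iic (M : ℝ) :
    LipschitzOnWith (Real.exp M).toNNReal Real.exp (Iic M) := by
  refine (convex_Iic M).lipschitzOnWith_of_nnnorm_deriv_le
    (fun x _ => Real.differentiableAt_exp) fun x hx => ?_
  rw [Real.deriv_exp, ← NNReal.coe_le_coe, coe_nnnorm, Real.norm_of_nonneg (Real.exp_pos x).le,
    Real.coe_toNNReal _ (Real.exp_pos M).le]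
  exact Real.exp_le_exp.2 hx

/-- The fundamental theorem of calculus for the exponential of a primitive. -/
theorem integral_mul_exp_primitive {g : ℝ → ℝ} {u t : ℝ} (hg : IntervalIntegrable g volume u t) :
    ∫ w in u..t, g w * Real.exp (∫ θ in u..w, g θ) = Real.exp (∫ θ in u..t, g θ) - 1 := by
  have hac : AbsolutelyContinuousOnInterval (fun w => ∫ θ in u..w, g θ) u t :=
    hg.absolutelyContinuousOnInterval_intervalIntegral (by simp)
  obtain ⟨C, hC⟩ := hac.exists_bound
  have hexp : AbsolutelyContinuousOnInterval (Real.exp ∘ fun w => ∫ θ in u..w, g θ) u t :=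
    AbsolutelyContinuousOnInterval.lipschitzOnWith_comp (lipschitzOnWith_exp_Iic C)
      (fun x hx => (le_abs_self _).trans (hC x hx)) hac
  have := hexp.integral_deriv_eq_sub
  simp only [Function.comp_apply, intervalIntegral.integral_same, Real.exp_zero] at this
  rw [← this]
  refine intervalIntegral.integral_congr_ae ?_
  filter_upwards [hg.ae_hasDerivAt_integral] with w hw hwm
  have := (hw (uIoc_subset_uIcc hwm) u (by simp)).exp
  rw [mul_comm]
  exact this.deriv.symm

/-- The survival probability `exp (-∫_u^w r)`. -/
noncomputable def surv (r : ℝ → ℝ≥0∞) (u w : ℝ) : ℝ≥0∞ :=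
  ENNReal.ofReal (Real.exp (-(∫⁻ θ in Ioo u w, r θ).toReal))

theorem surv_le_one (r : ℝ → ℝ≥0∞) (u w : ℝ) : surv r u w ≤ 1 := by
  unfold surv
  rw [← ENNReal.ofReal_one]
  refine ENNReal.ofReal_le_ofReal (Real.exp_le_one_iff.2 ?_)
  simp

section
variable {r : ℝ → ℝ≥0∞} {u t : ℝ}

theorem intervalIntegrable_toReal (hr : Measurable r) (hut : u ≤ t)
    (hfin : ∫⁻ θ in Ioo u t, r θ ≠ ∞) :
    IntervalIntegrable (fun θ => (r θ).toReal) volume u t := by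
  rw [intervalIntegrable_iff_integrableOn_Ioo_of_le hut]
  exact integrable_toReal_of_lintegral_ne_top hr.aemeasurable hfin

theorem toReal_lintegral_Ioo (hr : Measurable r) (hut : u ≤ t)
    (hfin : ∫⁻ θ in Ioo u t, r θ ≠ ∞) :
    (∫⁻ θ in Ioo u t, r θ).toReal = ∫ θ in u..t, (r θ).toReal := by
  rw [intervalIntegral.integral_of_le hut, integral_Ioc_eq_integral_Ioo,
    integral_toReal hr.aemeasurable (ae_lt_top hr hfin)]

theorem surv_eq (hr : Measurable r) (hut : u ≤ t) (hfin : ∫⁻ θ in Ioo u t, r θ ≠ ∞) :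
    surv r u t = ENNReal.ofReal (Real.exp (-∫ θ in u..t, (r θ).toReal)) := by
  rw [surv, toReal_lintegral_Ioo hr hut hfin]

theorem lintegral_mul_ofReal (hr : Measurable r) (hut : u ≤ t)
    (hfin : ∫⁻ θ in Ioo u t, r θ ≠ ∞) {F : ℝ → ℝ} (hF : ContinuousOn F (uIcc u t))
    (hF0 : ∀ w, 0 ≤ F w) :
    ∫⁻ w in Ioo u t, r w * ENNReal.ofReal (F w)
      = ENNReal.ofReal (∫ w in u..t, (r w).toReal * F w) := by
  have hi := (intervalIntegrable_toReal hr hut hfin).mul_continuousOn hF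
  rw [intervalIntegral.integral_of_le hut, integral_Ioc_eq_integral_Ioo,
    ofReal_integral_eq_lintegral_ofReal
      ((intervalIntegrable_iff_integrableOn_Ioo_of_le hut).1 hi)
      (Eventually.of_forall fun w => mul_nonneg ENNReal.toReal_nonneg (hF0 w))]
  refine lintegral_congr_ae ?_
  filter_upwards [ae_lt_top hr hfin] with w hw
  rw [ENNReal.ofReal_mul ENNReal.toReal_nonneg, ENNReal.ofReal_toReal hw.ne]

/-- An event occurring at rate `r` from time `u` on either has its first occurrence in `]u, t[`,
with density `r w * surv r u w`, or does not occur. Analytically the density is `-d/dw` of the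
survival function with moving end point. -/
theorem lintegral_mul_surv_left (hr : Measurable r) (hut : u ≤ t)
    (hfin : ∫⁻ θ in Ioo u t, r θ ≠ ∞) :
    (∫⁻ w in Ioo u t, r w * surv r u w) + surv r u t = 1 := by
  have hi := intervalIntegrable_toReal hr hut hfin
  have hc : ContinuousOn (fun w => ∫ θ in u..w, (r θ).toReal) (uIcc u t) :=
    (hi.absolutelyContinuousOnInterval_intervalIntegral (by simp)).continuousOn
  have h1 : ∫⁻ w in Ioo u t, r w * surv r u w = ∫⁻ w in Ioo u t, r w *
      ENNReal.ofReal (Real.exp (-∫ θ in u..w, (r θ).toReal)) := by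
    refine setLIntegral_congr_fun measurableSet_Ioo fun w hw => ?_
    rw [surv_eq hr hw.1.le
      (ne_top_of_le_ne_top hfin (lintegral_mono_set (Ioo_subset_Ioo_right hw.2.le)))]
  rw [h1, lintegral_mul_ofReal hr hut hfin (F := fun w => Real.exp (-∫ θ in u..w, (r θ).toReal))
      hc.neg.rexp (fun w => (Real.exp_pos _).le),
    surv_eq hr hut hfin, ← ENNReal.ofReal_add _ (Real.exp_pos _).le]
  · have := integral_mul_exp_primitive hi.neg
    simp only [Pi.neg_apply, neg_mul, intervalIntegral.integral_neg] at this
    rw [show ∫ w in u..t, (r w).toReal * Real.exp (-∫ θ in u..w, (r θ).toReal)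
      = 1 - Real.exp (-∫ θ in u..t, (r θ).toReal) by linarith]
    simp
  · exact intervalIntegral.integral_nonneg hut fun w _ => by positivity

/-- The time-reversed identity, conditioning on the last occurrence: here the integrand is `d/dw` of
the survival function with moving starting point. -/
theorem lintegral_mul_surv_right (hr : Measurable r) (hut : u ≤ t)
    (hfin : ∫⁻ θ in Ioo u t, r θ ≠ ∞) :
    (∫⁻ w in Ioo u t, r w * surv r w t) + surv r u t = 1 := by
  have hi := intervalIntegrable_toReal hr hut hfin
  have hc : ContinuousOn (fun w => ∫ θ in u..w, (r θ).toReal) (uIcc u t) :=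
    (hi.absolutelyContinuousOnInterval_intervalIntegral (by simp)).continuousOn
  have h1 : ∫⁻ w in Ioo u t, r w * surv r w t = ∫⁻ w in Ioo u t, r w *
      ENNReal.ofReal (Real.exp (∫ θ in u..w, (r θ).toReal) *
        Real.exp (-∫ θ in u..t, (r θ).toReal)) := by
    refine setLIntegral_congr_fun measurableSet_Ioo fun w hw => ?_
    have hs : Ioo w t ⊆ Ioo u t := Ioo_subset_Ioo_left hw.1.le
    rw [surv_eq hr hw.2.le (ne_top_of_le_ne_top hfin (lintegral_mono_set hs)), ← Real.exp_add,
      ← intervalIntegral.integral_add_adjacent_intervals (a := u) (b := w) (c := t)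
        (hi.mono_set (by rw [uIcc_of_le hw.1.le, uIcc_of_le hut]; exact Icc_subset_Icc_right hw.2.le))
        (hi.mono_set (by rw [uIcc_of_le hw.2.le, uIcc_of_le hut]; exact Icc_subset_Icc_left hw.1.le))]
    congr 3
    ring
  rw [h1, lintegral_mul_ofReal hr hut hfin
      (F := fun w => Real.exp (∫ θ in u..w, (r θ).toReal) *
        Real.exp (-∫ θ in u..t, (r θ).toReal)) (hc.rexp.mul continuousOn_const)
    (fun w => by positivity),
    surv_eq hr hut hfin, ← ENNReal.ofReal_add _ (Real.exp_pos _).le]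
  · have := integral_mul_exp_primitive hi
    simp only [← mul_assoc, intervalIntegral.integral_mul_const]
    rw [this, sub_mul, ← Real.exp_add]
    simp
  · exact intervalIntegral.integral_nonneg hut fun w _ => by positivity

end

variable {X : Type*} [MeasurableSpace X]

@[fun_prop]
theorem measurable_lintegral_Ioo {Y : Type*} [MeasurableSpace Y] {b c : Y → ℝ}
    {G : Y → ℝ → ℝ≥0∞} (hb : Measurable b) (hc : Measurable c)
    (hG : Measurable (Function.uncurry G)) :
    Measurable fun y => ∫⁻ θ in Ioo (b y) (c y), G y θ := by
  have hm : MeasurableSet {p : Y × ℝ | b p.1 < p.2 ∧ p.2 < c p.1} :=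
    (measurableSet_lt (hb.comp measurable_fst) measurable_snd).inter
      (measurableSet_lt measurable_snd (hc.comp measurable_fst))
  have : Measurable fun p : Y × ℝ => {p : Y × ℝ | b p.1 < p.2 ∧ p.2 < c p.1}.indicator
      (Function.uncurry G) p := hG.indicator hm
  convert! this.lintegral_prod_right' (ν := volume) using 2 with y
  rw [← lintegral_indicator measurableSet_Ioo]
  rfl

theorem measurable_surv {Y : Type*} [MeasurableSpace Y] {r : X → ℝ → ℝ≥0∞}
    (hr : Measurable (Function.uncurry r))
    {a : Y → X} {b c : Y → ℝ} (ha : Measurable a) (hb : Measurable b) (hc : Measurable c) :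
    Measurable fun y => surv (r (a y)) (b y) (c y) := by
  unfold surv
  have h : Measurable fun y => ∫⁻ θ in Ioo (b y) (c y), r (a y) θ :=
    measurable_lintegral_Ioo hb hc (hr.comp (by fun_prop : Measurable fun p : Y × ℝ => (a p.1, p.2)))
  fun_prop

/-- Both sides are the integral over the triangle `u < v < w < T`. -/
theorem lintegral_triangle_swap {F : ℝ → ℝ → ℝ≥0∞} (hF : Measurable (Function.uncurry F))
    (u T : ℝ) :
    ∫⁻ w in Ioo u T, ∫⁻ v in Ioo u w, F v w = ∫⁻ v in Ioo u T, ∫⁻ w in Ioo v T, F v w := by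
  let D : Set (ℝ × ℝ) := {p | u < p.1 ∧ p.1 < p.2 ∧ p.2 < T}
  have hD : MeasurableSet D :=
    (measurableSet_lt measurable_const measurable_fst).inter
      ((measurableSet_lt measurable_fst measurable_snd).inter
        (measurableSet_lt measurable_snd measurable_const))
  have hm : Measurable (D.indicator (Function.uncurry F)) := hF.indicator hD
  have h1 : ∫⁻ w in Ioo u T, ∫⁻ v in Ioo u w, F v w
      = ∫⁻ w, ∫⁻ v, D.indicator (Function.uncurry F) (v, w) := by
    rw [← lintegral_indicator measurableSet_Ioo]
    refine lintegral_congr fun w => ?_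
    by_cases hw : w ∈ Ioo u T
    · rw [indicator_of_mem hw, ← lintegral_indicator measurableSet_Ioo]
      refine lintegral_congr fun v => ?_
      by_cases hv : v ∈ Ioo u w
      · rw [indicator_of_mem hv, indicator_of_mem (show (v, w) ∈ D from ⟨hv.1, hv.2, hw.2⟩)]; rfl
      · rw [indicator_of_notMem hv, indicator_of_notMem]
        exact fun h => hv ⟨h.1, h.2.1⟩
    · rw [indicator_of_notMem hw]
      symm
      refine (lintegral_congr fun v => ?_).trans lintegral_zero
      exact indicator_of_notMem (fun h => hw ⟨h.1.trans h.2.1, h.2.2⟩) _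
  have h2 : ∫⁻ v in Ioo u T, ∫⁻ w in Ioo v T, F v w
      = ∫⁻ v, ∫⁻ w, D.indicator (Function.uncurry F) (v, w) := by
    rw [← lintegral_indicator measurableSet_Ioo]
    refine lintegral_congr fun v => ?_
    by_cases hv : v ∈ Ioo u T
    · rw [indicator_of_mem hv, ← lintegral_indicator measurableSet_Ioo]
      refine lintegral_congr fun w => ?_
      by_cases hw : w ∈ Ioo v T
      · rw [indicator_of_mem hw, indicator_of_mem (show (v, w) ∈ D from ⟨hv.1, hw.1, hw.2⟩)]; rfl
      · rw [indicator_of_notMem hw, indicator_of_notMem]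
        exact fun h => hw ⟨h.2.1, h.2.2⟩
    · rw [indicator_of_notMem hv]
      symm
      refine (lintegral_congr fun w => ?_).trans lintegral_zero
      exact indicator_of_notMem (fun h => hv ⟨h.1, h.2.1.trans h.2.2⟩) _
  rw [h1, h2]
  exact lintegral_lintegral_swap
    (f := fun w v => D.indicator (Function.uncurry F) (v, w)) (hm.comp measurable_swap).aemeasurable

end

/-! ### Duhamel's principle: mild form versus integrated balance. -/

section

variable {X : Type*} [MeasurableSpace X]

@[fun_prop]
theorem measurable_lintegral_kernel_comp {Y S : Type*} [MeasurableSpace Y] [MeasurableSpace S]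
    {κ : Kernel S X} [IsSFiniteKernel κ] {g : Y → S} {F : Y → X → ℝ≥0∞} (hg : Measurable g)
    (hF : Measurable (Function.uncurry F)) : Measurable fun p => ∫⁻ y, F p y ∂κ (g p) :=
  hF.lintegral_kernel_prod_right (κ := κ.comap g hg)

/-- A balance relation between measures and time integrals of kernels that holds on measurable sets
also holds for nonnegative measurable functions. -/
theorem lintegral_balance {μ m : Measure X} {K L : Kernel ℝ X} [IsSFiniteKernel K]
    [IsSFiniteKernel L] {a b : ℝ × X → ℝ≥0∞} (ha : Measurable a) (hb : Measurable b) (S : Set ℝ)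
    (h : ∀ A, MeasurableSet A → μ A + ∫⁻ w in S, ∫⁻ y in A, a (w, y) ∂K w
      = m A + ∫⁻ w in S, ∫⁻ y in A, b (w, y) ∂L w) {f : X → ℝ≥0∞} (hf : Measurable f) :
    ∫⁻ y, f y ∂μ + ∫⁻ w in S, ∫⁻ y, a (w, y) * f y ∂K w
      = ∫⁻ y, f y ∂m + ∫⁻ w in S, ∫⁻ y, b (w, y) * f y ∂L w := by
  have ha' : Measurable (Function.uncurry fun w y => a (w, y)) := ha
  have hb' : Measurable (Function.uncurry fun w y => b (w, y)) := hb
  -- The hypothesis is an equality of two measures evaluated on sets, so it may be integrated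
  -- against any `f`.
  have key : μ + (volume.restrict S).bind (K.withDensity fun w y => a (w, y))
      = m + (volume.restrict S).bind (L.withDensity fun w y => b (w, y)) := by
    ext A hA
    simp only [Measure.add_apply, Measure.bind_apply hA (Kernel.measurable _).aemeasurable,
      Kernel.withDensity_apply' _ ha', Kernel.withDensity_apply' _ hb']
    exact h A hA
  have := congrArg (fun ρ => ∫⁻ y, f y ∂ρ) key
  simpa only [lintegral_add_measure,
    Measure.lintegral_bind (Kernel.measurable _).aemeasurable hf.aemeasurable,
    Kernel.lintegral_withDensity _ ha' _ hf, Kernel.lintegral_withDensity _ hb' _ hf] using this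

section Duhamel

variable {r : X × ℝ → ℝ≥0∞} {e : X × ℝ × ℝ → ℝ≥0∞} {u T : ℝ} {M ν : Kernel ℝ X}
  [IsSFiniteKernel M] [IsSFiniteKernel ν] {m : Measure X} [SFinite m]

/-- Flow in the mild form, with survival function `e`, out of `m` with sources `ν`. -/
def IsMild (e : X × ℝ × ℝ → ℝ≥0∞) (u : ℝ) (M ν : Kernel ℝ X) (m : Measure X) (t : ℝ) : Prop :=
  ∀ A, MeasurableSet A → M t A =
    ∫⁻ y in A, e (y, u, t) ∂m + ∫⁻ w in Ioo u t, ∫⁻ y in A, e (y, w, t) ∂ν w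

/-- Integrated balance with killing rate `r`, out of `m` with sources `ν`. -/
def IsBalanced (r : X × ℝ → ℝ≥0∞) (u : ℝ) (M ν : Kernel ℝ X) (m : Measure X) (t : ℝ) : Prop :=
  ∀ A, MeasurableSet A → M t A + ∫⁻ w in Ioo u t, ∫⁻ y in A, r (y, w) ∂M w
    = m A + ∫⁻ w in Ioo u t, ν w A

omit [IsSFiniteKernel M] [SFinite m] in
theorem IsMild.lintegral (he : Measurable e) {t : ℝ} (h : IsMild e u M ν m t)
    {f : X → ℝ≥0∞} (hf : Measurable f) :
    ∫⁻ y, f y ∂M t = ∫⁻ y, e (y, u, t) * f y ∂m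
      + ∫⁻ w in Ioo u t, ∫⁻ y, e (y, w, t) * f y ∂ν w := by
  have := lintegral_balance (μ := M t) (m := m.withDensity fun y => e (y, u, t)) (K := ν) (L := ν)
    (a := fun _ => 0) (b := fun p => e (p.2, p.1, t)) (by fun_prop) (by fun_prop) (Ioo u t)
    (fun A hA => by simpa [withDensity_apply _ hA] using h A hA) hf
  rw [lintegral_withDensity_eq_lintegral_mul _ (by fun_prop) hf] at this
  simpa using this

omit [SFinite m] in
theorem IsBalanced.lintegral (hr : Measurable r) {t : ℝ} (h : IsBalanced r u M ν m t)
    {f : X → ℝ≥0∞} (hf : Measurable f) :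
    ∫⁻ y, f y ∂M t + ∫⁻ w in Ioo u t, ∫⁻ y, r (y, w) * f y ∂M w
      = ∫⁻ y, f y ∂m + ∫⁻ w in Ioo u t, ∫⁻ y, f y ∂ν w := by
  have := lintegral_balance (μ := M t) (m := m) (K := M) (L := ν)
    (a := fun p => r (p.2, p.1)) (b := fun p => 1) (by fun_prop) (by fun_prop) (Ioo u t)
    (fun A hA => by simpa using h A hA) hf
  simpa using this

omit [IsSFiniteKernel M] in
-- Mass injected at time `v` is either killed during `]v, T[` or alive at `T`. Inserting the mild
-- form into the outflow and exchanging the order of time shows that the two parts add up to the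
-- injected mass by `hre`.
theorem IsMild.balanced_univ (hr : Measurable r) (he : Measurable e) (huT : u < T)
    (hre : ∀ y, ∀ v ∈ Ico u T, (∫⁻ w in Ioo v T, r (y, w) * e (y, v, w)) + e (y, v, T) = 1)
    (hM : ∀ t ∈ Ioc u T, IsMild e u M ν m t) :
    M T univ + ∫⁻ w in Ioo u T, ∫⁻ y, r (y, w) ∂M w = m univ + ∫⁻ w in Ioo u T, ν w univ := by
  have h1 : ∫⁻ w in Ioo u T, ∫⁻ y, r (y, w) ∂M w
      = ∫⁻ y, (∫⁻ w in Ioo u T, r (y, w) * e (y, u, w)) ∂m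
        + ∫⁻ v in Ioo u T, ∫⁻ y, (∫⁻ w in Ioo v T, r (y, w) * e (y, v, w)) ∂ν v := by
    calc ∫⁻ w in Ioo u T, ∫⁻ y, r (y, w) ∂M w
        = ∫⁻ w in Ioo u T, (∫⁻ y, r (y, w) * e (y, u, w) ∂m
          + ∫⁻ v in Ioo u w, ∫⁻ y, r (y, w) * e (y, v, w) ∂ν v) := by
          refine setLIntegral_congr_fun measurableSet_Ioo fun w hw => ?_
          simp only [mul_comm (r _)]
          exact (hM w ⟨hw.1, hw.2.le⟩).lintegral he (by fun_prop)
      _ = _ := by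
          rw [lintegral_add_left (by fun_prop), lintegral_lintegral_swap (by fun_prop),
            lintegral_triangle_swap (F := fun v w => ∫⁻ y, r (y, w) * e (y, v, w) ∂ν v)
              (by unfold Function.uncurry; fun_prop)]
          congr 1
          refine lintegral_congr fun v => ?_
          rw [lintegral_lintegral_swap (by fun_prop)]
  rw [h1, hM T ⟨huT, le_rfl⟩ univ MeasurableSet.univ]
  simp only [Measure.restrict_univ]
  have h2 : ∫⁻ y, e (y, u, T) ∂m + ∫⁻ y, (∫⁻ w in Ioo u T, r (y, w) * e (y, u, w)) ∂m = m univ := by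
    rw [← lintegral_add_left (by fun_prop), ← lintegral_one]
    refine lintegral_congr fun y => ?_
    rw [add_comm, hre y u ⟨le_rfl, huT⟩]
  have h3 : (∫⁻ w in Ioo u T, ∫⁻ y, e (y, w, T) ∂ν w)
      + ∫⁻ v in Ioo u T, ∫⁻ y, (∫⁻ w in Ioo v T, r (y, w) * e (y, v, w)) ∂ν v
      = ∫⁻ w in Ioo u T, ν w univ := by
    rw [← lintegral_add_left (by fun_prop)]
    refine setLIntegral_congr_fun measurableSet_Ioo fun v hv => ?_
    rw [← lintegral_add_left (by fun_prop), ← lintegral_one]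
    refine lintegral_congr fun y => ?_
    rw [add_comm, hre y v ⟨hv.1.le, hv.2⟩]
  rw [← h2, ← h3]
  ring

/-- The balance at time `w` is tested against `r (·, w) * e (·, w, T)` and integrated over `w`. By
`hre` the terms in `M` collapse to the plain outflow, which then cancels in the balance at `T`;
`hfin` permits this cancellation in `ℝ≥0∞`. -/
theorem IsBalanced.mild_univ (hr : Measurable r) (he : Measurable e) (huT : u < T)
    (hre : ∀ y, ∀ v ∈ Ico u T, (∫⁻ w in Ioo v T, r (y, w) * e (y, w, T)) + e (y, v, T) = 1)
    (hM : ∀ t ∈ Ioc u T, IsBalanced r u M ν m t)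
    (hfin : ∫⁻ w in Ioo u T, ∫⁻ y, r (y, w) ∂M w ≠ ∞) :
    M T univ = ∫⁻ y, e (y, u, T) ∂m + ∫⁻ w in Ioo u T, ∫⁻ y, e (y, w, T) ∂ν w := by
  have h1 : ∫⁻ y, (∫⁻ w in Ioo u T, r (y, w) * e (y, w, T)) ∂m
        + ∫⁻ v in Ioo u T, ∫⁻ y, (∫⁻ w in Ioo v T, r (y, w) * e (y, w, T)) ∂ν v
      = ∫⁻ w in Ioo u T, ∫⁻ y, r (y, w) ∂M w := by
    calc _ = ∫⁻ w in Ioo u T, (∫⁻ y, r (y, w) * e (y, w, T) ∂m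
          + ∫⁻ v in Ioo u w, ∫⁻ y, r (y, w) * e (y, w, T) ∂ν v) := by
          rw [lintegral_add_left (by fun_prop), lintegral_lintegral_swap (by fun_prop),
            lintegral_triangle_swap (F := fun v w => ∫⁻ y, r (y, w) * e (y, w, T) ∂ν v)
              (by unfold Function.uncurry; fun_prop)]
          congr 1
          refine lintegral_congr fun v => ?_
          rw [lintegral_lintegral_swap (by fun_prop)]
      _ = ∫⁻ w in Ioo u T, (∫⁻ y, r (y, w) * e (y, w, T) ∂M w
          + ∫⁻ v in Ioo u w, ∫⁻ y, r (y, v) * (r (y, w) * e (y, w, T)) ∂M v) := by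
          refine setLIntegral_congr_fun measurableSet_Ioo fun w hw => ?_
          exact ((hM w ⟨hw.1, hw.2.le⟩).lintegral hr (by fun_prop)).symm
      _ = (∫⁻ w in Ioo u T, ∫⁻ y, r (y, w) * e (y, w, T) ∂M w)
          + ∫⁻ v in Ioo u T, ∫⁻ y, r (y, v) * (∫⁻ w in Ioo v T, r (y, w) * e (y, w, T)) ∂M v := by
          rw [lintegral_add_left (by fun_prop), lintegral_triangle_swap
            (F := fun v w => ∫⁻ y, r (y, v) * (r (y, w) * e (y, w, T)) ∂M v)
            (by unfold Function.uncurry; fun_prop)]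
          congr 1
          refine lintegral_congr fun v => ?_
          rw [lintegral_lintegral_swap (by fun_prop)]
          refine lintegral_congr fun y => ?_
          rw [lintegral_const_mul _ (by fun_prop)]
      _ = _ := by
          -- The common factor `r (y, v)` multiplies exactly the left side of `hre`.
          rw [← lintegral_add_left (by fun_prop)]
          refine setLIntegral_congr_fun measurableSet_Ioo fun v hv => ?_
          rw [← lintegral_add_left (by fun_prop)]
          refine lintegral_congr fun y => ?_
          rw [← mul_add, add_comm, hre y v ⟨hv.1.le, hv.2⟩, mul_one]
  have h2 : ∫⁻ y, e (y, u, T) ∂m + ∫⁻ y, (∫⁻ w in Ioo u T, r (y, w) * e (y, w, T)) ∂m = m univ := by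
    rw [← lintegral_add_left (by fun_prop), ← lintegral_one]
    refine lintegral_congr fun y => ?_
    rw [add_comm, hre y u ⟨le_rfl, huT⟩]
  have h3 : (∫⁻ w in Ioo u T, ∫⁻ y, e (y, w, T) ∂ν w)
      + ∫⁻ v in Ioo u T, ∫⁻ y, (∫⁻ w in Ioo v T, r (y, w) * e (y, w, T)) ∂ν v
      = ∫⁻ w in Ioo u T, ν w univ := by
    rw [← lintegral_add_left (by fun_prop)]
    refine setLIntegral_congr_fun measurableSet_Ioo fun v hv => ?_
    rw [← lintegral_add_left (by fun_prop), ← lintegral_one]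
    refine lintegral_congr fun y => ?_
    rw [add_comm, hre y v ⟨hv.1.le, hv.2⟩]
  have h4 := hM T ⟨huT, le_rfl⟩ univ MeasurableSet.univ
  simp only [Measure.restrict_univ] at h4
  rw [← h2, ← h3, ← h1] at h4
  rw [← h1] at hfin
  refine (ENNReal.add_left_inj hfin).1 (h4.trans ?_)
  ring

omit [IsSFiniteKernel M] [IsSFiniteKernel ν] [SFinite m] in
-- Nothing moves between jumps, so the mild form is local in space. This reduces statements about a
-- set to statements about total mass.
theorem IsMild.restrict {t : ℝ} (h : IsMild e u M ν m t) {B : Set X} (hB : MeasurableSet B) :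
    IsMild e u (M.restrict hB) (ν.restrict hB) (m.restrict B) t := by
  intro A hA
  simpa [Kernel.restrict_apply, Measure.restrict_apply hA, Measure.restrict_restrict hA]
    using h (A ∩ B) (hA.inter hB)

omit [IsSFiniteKernel M] in
theorem IsMild.balanced (hr : Measurable r) (he : Measurable e) (huT : u < T)
    (hre : ∀ y, ∀ v ∈ Ico u T, (∫⁻ w in Ioo v T, r (y, w) * e (y, v, w)) + e (y, v, T) = 1)
    (hM : ∀ t ∈ Ioc u T, IsMild e u M ν m t) : IsBalanced r u M ν m T := by
  intro A hA
  simpa [Kernel.restrict_apply] using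
    IsMild.balanced_univ hr he huT hre (fun t ht => (hM t ht).restrict hA)

/-- If the balance relation holds for all measurable subsets of `A`, then `A` satisfies the mild
equation. -/
theorem mild_of_balanced_subsets (hr : Measurable r) (he : Measurable e) (huT : u < T)
    (hre : ∀ y, ∀ v ∈ Ico u T, (∫⁻ w in Ioo v T, r (y, w) * e (y, w, T)) + e (y, v, T) = 1)
    {A : Set X} (hA : MeasurableSet A)
    (hM : ∀ t ∈ Ioc u T, ∀ A' ⊆ A, MeasurableSet A' →
      M t A' + ∫⁻ w in Ioo u t, ∫⁻ y in A', r (y, w) ∂M w = m A' + ∫⁻ w in Ioo u t, ν w A')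
    (hfin : ∫⁻ w in Ioo u T, ∫⁻ y in A, r (y, w) ∂M w ≠ ∞) :
    M T A = ∫⁻ y in A, e (y, u, T) ∂m + ∫⁻ w in Ioo u T, ∫⁻ y in A, e (y, w, T) ∂ν w := by
  have := IsBalanced.mild_univ (M := M.restrict hA) (ν := ν.restrict hA) (m := m.restrict A)
    hr he huT hre (fun t ht A' hA' => ?_) (by simpa [Kernel.restrict_apply] using hfin)
  · simpa [Kernel.restrict_apply] using this
  · simpa [Kernel.restrict_apply, Measure.restrict_apply hA', Measure.restrict_restrict hA']
      using hM t ht (A' ∩ A) inter_subset_right (hA'.inter hA)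

end Duhamel

end

/-! ### Feller's iterates as kernels and the minimal flow. -/

section

variable {X : Type*} [MeasurableSpace X]

section FellerKernel

variable (κ : Kernel (X × ℝ) X)

/-- The total jump rate of the kernel `κ`. -/
noncomputable def totalRate (p : X × ℝ) : ℝ≥0∞ := κ p univ

/-- The probability of not jumping out of `p.1` during `]p.2.1, p.2.2[`. -/
noncomputable def survival (p : X × ℝ × ℝ) : ℝ≥0∞ :=
  surv (fun θ => totalRate κ (p.1, θ)) p.2.1 p.2.2

@[fun_prop]
theorem measurable_totalRate : Measurable (totalRate κ) := κ.measurable_coe MeasurableSet.univ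

@[fun_prop]
theorem measurable_survival : Measurable (survival κ) :=
  measurable_surv (r := fun x θ => totalRate κ (x, θ)) (measurable_totalRate κ)
    measurable_fst (measurable_fst.comp measurable_snd) (measurable_snd.comp measurable_snd)

theorem survival_le_one (p : X × ℝ × ℝ) : survival κ p ≤ 1 := surv_le_one _ _ _

/-- Before time `t` the rates of `κ` are integrable in time. -/
def HasIntegrableRates (t : ℝ) : Prop := ∀ x, ∫⁻ θ in Iio t, totalRate κ (x, θ) ≠ ∞

variable {κ} in
theorem HasIntegrableRates.mono {s t : ℝ} (h : HasIntegrableRates κ t) (hst : s ≤ t) :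
    HasIntegrableRates κ s :=
  fun x => ne_top_of_le_ne_top (h x) (lintegral_mono_set (Iio_subset_Iio hst))

variable {κ} in
theorem HasIntegrableRates.survival_left {t u : ℝ} (h : HasIntegrableRates κ t) (hut : u ≤ t)
    (x : X) : (∫⁻ w in Ioo u t, totalRate κ (x, w) * survival κ (x, u, w))
      + survival κ (x, u, t) = 1 :=
  lintegral_mul_surv_left (r := fun θ => totalRate κ (x, θ)) (by fun_prop) hut
    (ne_top_of_le_ne_top (h x) (lintegral_mono_set fun _ hw => hw.2))

variable {κ} in
theorem HasIntegrableRates.survival_right {t u : ℝ} (h : HasIntegrableRates κ t) (hut : u ≤ t)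
    (x : X) : (∫⁻ w in Ioo u t, totalRate κ (x, w) * survival κ (x, w, t))
      + survival κ (x, u, t) = 1 :=
  lintegral_mul_surv_right (r := fun θ => totalRate κ (x, θ)) (by fun_prop) hut
    (ne_top_of_le_ne_top (h x) (lintegral_mono_set fun _ hw => hw.2))

/-- The flow of jumps out of the time-dependent distribution `M`. -/
noncomputable def jumpFlow (M : Kernel ℝ X) : Kernel ℝ X :=
  κ ∘ₖ (M ×ₖ Kernel.id)

variable [IsSFiniteKernel κ]

/-- The law of the first jump (its time and target) out of `(u, x, t)` during `]u, t[`. -/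
noncomputable def firstJump : Kernel (ℝ × X × ℝ) (ℝ × X) :=
  (Kernel.const (ℝ × X × ℝ) (volume : Measure ℝ) ⊗ₖ
    κ.comap (fun p : (ℝ × X × ℝ) × ℝ => (p.1.2.1, p.2)) (by fun_prop)).withDensity
    fun z p => (Ioo z.1 z.2.2).indicator (fun w => survival κ (z.2.1, z.1, w)) p.1

omit [IsSFiniteKernel κ] in
theorem measurable_firstJump_density :
    Measurable (Function.uncurry fun (z : ℝ × X × ℝ) (p : ℝ × X) =>
      (Ioo z.1 z.2.2).indicator (fun w => survival κ (z.2.1, z.1, w)) p.1) := by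
  have hm : MeasurableSet {q : (ℝ × X × ℝ) × (ℝ × X) | q.1.1 < q.2.1 ∧ q.2.1 < q.1.2.2} :=
    (measurableSet_lt (f := fun q : (ℝ × X × ℝ) × (ℝ × X) => q.1.1) (g := fun q => q.2.1)
      (by fun_prop) (by fun_prop)).inter
      (measurableSet_lt (f := fun q : (ℝ × X × ℝ) × (ℝ × X) => q.2.1) (g := fun q => q.1.2.2)
        (by fun_prop) (by fun_prop))
  have : Measurable fun q : (ℝ × X × ℝ) × (ℝ × X) => survival κ (q.1.2.1, q.1.1, q.2.1) := by
    fun_prop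
  exact this.indicator hm

instance : IsSFiniteKernel (firstJump κ) := by
  refine Kernel.IsSFiniteKernel.withDensity _ fun z p => ?_
  refine ne_top_of_le_ne_top ENNReal.one_ne_top ?_
  exact indicator_le' (fun w _ => survival_le_one κ _) (fun _ _ => zero_le) _

theorem lintegral_firstJump (u : ℝ) (x : X) (t : ℝ) {f : ℝ × X → ℝ≥0∞} (hf : Measurable f) :
    ∫⁻ p, f p ∂firstJump κ (u, x, t)
      = ∫⁻ w in Ioo u t, ∫⁻ y, survival κ (x, u, w) * f (w, y) ∂κ (x, w) := by
  rw [firstJump, Kernel.lintegral_withDensity _ (measurable_firstJump_density κ) _ hf,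
    Kernel.lintegral_compProd _ _ _
      (f := fun p => (Ioo u t).indicator (fun w => survival κ (x, u, w)) p.1 * f p)
      (((measurable_firstJump_density κ).comp (measurable_prodMk_left (x := (u, x, t)))).mul hf),
    ← lintegral_indicator measurableSet_Ioo]
  simp only [Kernel.const_apply]
  refine lintegral_congr fun w => ?_
  by_cases hw : w ∈ Ioo u t
  · simp [hw, Kernel.comap_apply]
  · simp [hw]

/-- The process restarted after the first jump, with the same terminal time. -/
noncomputable def restart : Kernel (ℝ × X × ℝ) (ℝ × X × ℝ) :=
  (Kernel.id ×ₖ firstJump κ).map fun p => (p.2.1, p.2.2, p.1.2.2)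

instance : IsSFiniteKernel (restart κ) := by unfold restart; infer_instance

theorem lintegral_restart (u : ℝ) (x : X) (t : ℝ) {f : ℝ × X × ℝ → ℝ≥0∞} (hf : Measurable f) :
    ∫⁻ p, f p ∂restart κ (u, x, t)
      = ∫⁻ w in Ioo u t, ∫⁻ y, survival κ (x, u, w) * f (w, y, t) ∂κ (x, w) := by
  rw [restart, Kernel.lintegral_map _ (by fun_prop) _ hf, Kernel.lintegral_prod _ _ _ (by fun_prop),
    Kernel.lintegral_id' (by fun_prop), lintegral_firstJump κ u x t
      (f := fun c => f (c.1, c.2, t)) (by fun_prop)]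

/-- The kernel of exactly `n` jumps, in the variable `(u, x, t)`. -/
noncomputable def fellerKernel : ℕ → Kernel (ℝ × X × ℝ) X
  | 0 => (Kernel.deterministic (fun z : ℝ × X × ℝ => z.2.1) (by fun_prop)).withDensity
      fun z _ => survival κ (z.2.1, z.1, z.2.2)
  | n + 1 => fellerKernel n ∘ₖ restart κ

instance (n : ℕ) : IsSFiniteKernel (fellerKernel κ n) := by
  induction n with
  | zero => exact Kernel.IsSFiniteKernel.withDensity _ fun z p =>
      ne_top_of_le_ne_top ENNReal.one_ne_top (survival_le_one κ _)
  | succ n ih => unfold fellerKernel; infer_instance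

omit [IsSFiniteKernel κ] in
theorem lintegral_fellerKernel_zero (u : ℝ) (x : X) (t : ℝ) {f : X → ℝ≥0∞} (hf : Measurable f) :
    ∫⁻ y, f y ∂fellerKernel κ 0 (u, x, t) = survival κ (x, u, t) * f x := by
  rw [fellerKernel, Kernel.lintegral_withDensity _ (by unfold Function.uncurry; fun_prop) _ hf,
    Kernel.lintegral_deterministic' (f := fun y => survival κ (x, u, t) * f y) (by fun_prop)]
  fun_prop

theorem lintegral_fellerKernel_succ (n : ℕ) (u : ℝ) (x : X) (t : ℝ) {f : X → ℝ≥0∞}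
    (hf : Measurable f) :
    ∫⁻ y, f y ∂fellerKernel κ (n + 1) (u, x, t)
      = ∫⁻ w in Ioo u t, ∫⁻ y, survival κ (x, u, w) * ∫⁻ z, f z ∂fellerKernel κ n (w, y, t)
        ∂κ (x, w) := by
  rw [fellerKernel, Kernel.lintegral_comp _ _ _ hf, lintegral_restart κ u x t (by fun_prop)]

/-- Forward recursion: conditioning on the last jump. -/
theorem lintegral_fellerKernel_succ_forward (n : ℕ) (u : ℝ) (x : X) (t : ℝ) {f : X → ℝ≥0∞}
    (hf : Measurable f) :
    ∫⁻ y, f y ∂fellerKernel κ (n + 1) (u, x, t)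
      = ∫⁻ w in Ioo u t, ∫⁻ z, ∫⁻ y, survival κ (y, w, t) * f y ∂κ (z, w)
        ∂fellerKernel κ n (u, x, w) := by
  induction n generalizing u x with
  | zero =>
    rw [lintegral_fellerKernel_succ κ 0 u x t hf]
    refine lintegral_congr fun w => ?_
    rw [lintegral_fellerKernel_zero κ u x w (by fun_prop), ← lintegral_const_mul _ (by fun_prop)]
    refine lintegral_congr fun y => ?_
    rw [lintegral_fellerKernel_zero κ w y t hf]
  | succ n ih =>
    have hg : Measurable fun p : X × ℝ => ∫⁻ y, survival κ (y, p.2, t) * f y ∂κ p := by fun_prop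
    -- The first jump, at `w`, is split off by definition and the last one, at `v`, by induction.
    -- Exchanging the times `u < w < v < t` lets the first jump be absorbed again into the iterate
    -- up to time `v`.
    calc _ = ∫⁻ w in Ioo u t, ∫⁻ v in Ioo w t, ∫⁻ y, survival κ (x, u, w) *
            ∫⁻ z, (∫⁻ y, survival κ (y, v, t) * f y ∂κ (z, v)) ∂fellerKernel κ n (w, y, v)
            ∂κ (x, w) := by
          rw [lintegral_fellerKernel_succ κ (n + 1) u x t hf]
          refine lintegral_congr fun w => ?_
          rw [lintegral_lintegral_swap
            (Measurable.aemeasurable (by unfold Function.uncurry; fun_prop))]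
          refine lintegral_congr fun y => ?_
          rw [ih w y, lintegral_const_mul _ (by fun_prop)]
      _ = _ := by
          rw [← lintegral_triangle_swap (F := fun w v => ∫⁻ y, survival κ (x, u, w) *
            ∫⁻ z, (∫⁻ y, survival κ (y, v, t) * f y ∂κ (z, v)) ∂fellerKernel κ n (w, y, v)
            ∂κ (x, w)) (by unfold Function.uncurry; fun_prop)]
          refine lintegral_congr fun v => ?_
          rw [lintegral_fellerKernel_succ κ n u x v (by fun_prop)]

omit [IsSFiniteKernel κ] in
theorem fellerKernel_zero_apply (u : ℝ) (x : X) (t : ℝ) {A : Set X} (hA : MeasurableSet A) :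
    fellerKernel κ 0 (u, x, t) A = A.indicator (fun y => survival κ (y, u, t)) x := by
  have := lintegral_fellerKernel_zero κ u x t (f := A.indicator 1) (measurable_one.indicator hA)
  rw [lintegral_indicator_one hA] at this
  rw [this]
  by_cases hx : x ∈ A <;> simp [hx]

theorem fellerKernel_succ_apply (n : ℕ) (u : ℝ) (x : X) (t : ℝ) {A : Set X}
    (hA : MeasurableSet A) :
    fellerKernel κ (n + 1) (u, x, t) A
      = ∫⁻ w in Ioo u t, ∫⁻ y, survival κ (x, u, w) * fellerKernel κ n (w, y, t) A ∂κ (x, w) := by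
  have := lintegral_fellerKernel_succ κ n u x t (f := A.indicator 1) (measurable_one.indicator hA)
  simpa only [lintegral_indicator_one hA] using this

theorem fellerKernel_succ_apply_forward (n : ℕ) (u : ℝ) (x : X) (t : ℝ) {A : Set X}
    (hA : MeasurableSet A) :
    fellerKernel κ (n + 1) (u, x, t) A
      = ∫⁻ w in Ioo u t, ∫⁻ z, ∫⁻ y in A, survival κ (y, w, t) ∂κ (z, w)
        ∂fellerKernel κ n (u, x, w) := by
  have := lintegral_fellerKernel_succ_forward κ n u x t (f := A.indicator 1)
    (measurable_one.indicator hA)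
  rw [lintegral_indicator_one hA] at this
  rw [this]
  refine lintegral_congr fun w => lintegral_congr fun z => ?_
  rw [← lintegral_indicator hA]
  refine lintegral_congr fun y => ?_
  by_cases hy : y ∈ A <;> simp [hy]

/-- The transition kernel of the minimal process, in the variable `(u, x, t)`. -/
noncomputable def minimalKernel : Kernel (ℝ × X × ℝ) X := Kernel.sum (fellerKernel κ)

instance : IsSFiniteKernel (minimalKernel κ) := by unfold minimalKernel; infer_instance

variable {κ} in
-- Conditioning on the first jump, at most unit mass continues from each landing point by induction.
-- So the total is at most the probability of a first jump before `t` plus that of none, which is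
-- one by `HasIntegrableRates.survival_left`.
theorem sum_fellerKernel_univ_le_one {t : ℝ} (h : HasIntegrableRates κ t) (N : ℕ) {u : ℝ}
    (hut : u ≤ t) (x : X) :
    ∑ n ∈ Finset.range N, fellerKernel κ n (u, x, t) univ ≤ 1 := by
  induction N generalizing u x with
  | zero => simp
  | succ N ih =>
    rw [Finset.sum_range_succ', fellerKernel_zero_apply κ u x t MeasurableSet.univ,
      indicator_univ, ← h.survival_left hut x]
    gcongr
    simp only [fellerKernel_succ_apply κ _ u x t MeasurableSet.univ]
    have hmeas (n : ℕ) : Measurable fun p : ℝ × X => fellerKernel κ n (p.1, p.2, t) univ :=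
      ((fellerKernel κ n).measurable_coe MeasurableSet.univ).comp (by fun_prop)
    rw [← lintegral_finsetSum _ fun n _ => ?_]
    · refine setLIntegral_mono' measurableSet_Ioo fun w hw => ?_
      rw [← lintegral_finsetSum _ fun n _ => ?_]
      · calc _ ≤ ∫⁻ y, survival κ (x, u, w) ∂κ (x, w) := by
              refine lintegral_mono fun y => ?_
              rw [← Finset.mul_sum]
              exact mul_le_of_le_one_right zero_le (ih hw.2.le y)
          _ = _ := by rw [lintegral_const, mul_comm]; rfl
      · exact ((hmeas n).comp measurable_prodMk_left).const_mul _
    · have := hmeas n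
      have h2 : Measurable fun q : ℝ × X => survival κ (x, u, q.1) *
          fellerKernel κ n (q.1, q.2, t) univ := by fun_prop
      exact measurable_lintegral_kernel_comp (g := fun w : ℝ => (x, w)) (by fun_prop) h2

variable {κ} in
theorem minimalKernel_univ_le_one {t : ℝ} (h : HasIntegrableRates κ t) {u : ℝ}
    (hut : u ≤ t) (x : X) : minimalKernel κ (u, x, t) univ ≤ 1 := by
  rw [minimalKernel, Kernel.sum_apply' _ _ MeasurableSet.univ]
  exact ENNReal.tsum_le_of_sum_range_le fun N => sum_fellerKernel_univ_le_one h N hut x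

instance (M : Kernel ℝ X) : IsSFiniteKernel (jumpFlow κ M) := by unfold jumpFlow; infer_instance

omit [IsSFiniteKernel κ] in
theorem lintegral_jumpFlow (M : Kernel ℝ X) [IsSFiniteKernel M] (w : ℝ) {f : X → ℝ≥0∞}
    (hf : Measurable f) :
    ∫⁻ y, f y ∂jumpFlow κ M w = ∫⁻ z, ∫⁻ y, f y ∂κ (z, w) ∂M w := by
  rw [jumpFlow, Kernel.lintegral_comp _ _ _ hf, Kernel.lintegral_prod _ _ _ (by fun_prop)]
  refine lintegral_congr fun z => ?_
  rw [Kernel.lintegral_id' (by fun_prop)]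

omit [IsSFiniteKernel κ] in
theorem setLIntegral_jumpFlow (M : Kernel ℝ X) [IsSFiniteKernel M] (w : ℝ) {f : X → ℝ≥0∞}
    (hf : Measurable f) {A : Set X} (hA : MeasurableSet A) :
    ∫⁻ y in A, f y ∂jumpFlow κ M w = ∫⁻ z, ∫⁻ y in A, f y ∂κ (z, w) ∂M w := by
  simp only [← lintegral_indicator hA]
  exact lintegral_jumpFlow κ M w (hf.indicator hA)

omit [IsSFiniteKernel κ] in
theorem jumpFlow_apply (M : Kernel ℝ X) [IsSFiniteKernel M] (w : ℝ) {A : Set X}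
    (hA : MeasurableSet A) : jumpFlow κ M w A = ∫⁻ z, κ (z, w) A ∂M w := by
  simpa using setLIntegral_jumpFlow κ M w (f := fun _ => 1) measurable_const hA

/-- The distribution of the minimal process at a variable terminal time. -/
noncomputable def minimalFrom (u : ℝ) (x : X) : Kernel ℝ X :=
  (minimalKernel κ).comap (fun t => (u, x, t)) (by fun_prop)

instance (u : ℝ) (x : X) : IsSFiniteKernel (minimalFrom κ u x) := by
  unfold minimalFrom; infer_instance

/-- The zeroth iterate is the undisturbed initial mass, and the last-jump recursion summed over `n`
is the source term. -/
theorem isMild_minimalFrom (u : ℝ) (x : X) (t : ℝ) :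
    IsMild (survival κ) u (minimalFrom κ u x) (jumpFlow κ (minimalFrom κ u x))
      (Measure.dirac x) t := by
  intro A hA
  have h1 : ∫⁻ w in Ioo u t, ∫⁻ y in A, survival κ (y, w, t) ∂jumpFlow κ (minimalFrom κ u x) w
      = ∑' n, fellerKernel κ (n + 1) (u, x, t) A := by
    simp only [fellerKernel_succ_apply_forward κ _ u x t hA]
    have hm : Measurable fun p : X × ℝ => ∫⁻ y in A, survival κ (y, p.2, t) ∂κ p :=
      Measurable.setLIntegral_kernel_prod_right (by unfold Function.uncurry; fun_prop) hA
    rw [← lintegral_tsum fun n => ?_]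
    · refine lintegral_congr fun w => ?_
      rw [setLIntegral_jumpFlow κ _ w (by fun_prop) hA, minimalFrom, Kernel.comap_apply,
        minimalKernel, Kernel.sum_apply, lintegral_sum_measure]
    · exact Measurable.aemeasurable (measurable_lintegral_kernel_comp
        (g := fun w : ℝ => (u, x, w)) (by fun_prop)
        (hm.comp (measurable_snd.prodMk measurable_fst)))
  rw [h1, minimalFrom, Kernel.comap_apply, minimalKernel, Kernel.sum_apply' _ _ hA,
    tsum_eq_zero_add' ENNReal.summable, fellerKernel_zero_apply κ u x t hA,
    ← lintegral_indicator hA, lintegral_dirac' _ ((by fun_prop : Measurable _).indicator hA)]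

/-- Any mild flow out of `x` dominates the minimal one. -/
theorem minimalFrom_le_of_isMild {u T : ℝ} {x : X} {M : Kernel ℝ X} [IsSFiniteKernel M]
    (hM : ∀ t ∈ Ioc u T, IsMild (survival κ) u M (jumpFlow κ M) (Measure.dirac x) t)
    {t : ℝ} (ht : t ∈ Ioc u T) : minimalFrom κ u x t ≤ M t := by
  have key (N : ℕ) : ∀ t ∈ Ioc u T,
      ∑ n ∈ Finset.range N, fellerKernel κ n (u, x, t) ≤ M t := by
    induction N with
    | zero => intro t _; simpa using Measure.zero_le _
    | succ N ih =>
      intro t ht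
      refine Measure.le_iff.2 fun A hA => ?_
      -- Both sides have the same no-jump term; in the source term the induction hypothesis is used
      -- at all earlier times `w`.
      rw [hM t ht A hA, Measure.finsetSum_apply, Finset.sum_range_succ', add_comm,
        fellerKernel_zero_apply κ u x t hA, ← lintegral_indicator hA,
        lintegral_dirac' _ ((by fun_prop : Measurable _).indicator hA)]
      gcongr
      simp only [fellerKernel_succ_apply_forward κ _ u x t hA]
      have hm : Measurable fun p : X × ℝ => ∫⁻ y in A, survival κ (y, p.2, t) ∂κ p :=
        Measurable.setLIntegral_kernel_prod_right (by unfold Function.uncurry; fun_prop) hA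
      rw [← lintegral_finsetSum _ fun n _ => ?_]
      · refine setLIntegral_mono' measurableSet_Ioo fun w hw => ?_
        rw [setLIntegral_jumpFlow κ M w (by fun_prop) hA, ← lintegral_finsetSum_measure]
        exact lintegral_mono' (ih w ⟨hw.1, hw.2.le.trans ht.2⟩) le_rfl
      · exact measurable_lintegral_kernel_comp
          (g := fun w : ℝ => (u, x, w)) (by fun_prop)
          (hm.comp (measurable_snd.prodMk measurable_fst))
  refine Measure.le_iff.2 fun A hA => ?_
  rw [minimalFrom, Kernel.comap_apply, minimalKernel, Kernel.sum_apply' _ _ hA]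
  refine ENNReal.tsum_le_of_sum_range_le fun N => ?_
  have := Measure.le_iff.1 (key N t ht) A hA
  rwa [Measure.finsetSum_apply] at this

end FellerKernel

end

/-! ### Novikov's separation theorem and covers by sets with bounded rates. -/

section

section Novikov

variable {X : Type*}

/-- A sequence of sets that can be enlarged to measurable sets with empty intersection. -/
def MeasurablySeparableSeq [MeasurableSpace X] (C : ℕ → Set X) : Prop :=
  ∃ B : ℕ → Set X, (∀ n, MeasurableSet (B n)) ∧ (∀ n, C n ⊆ B n) ∧ ⋂ n, B n = ∅

/-- The image under `f i` of the sequences whose coordinates coded by numbers less than `k` are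
those prescribed by `z`. -/
def codedImage (f : ℕ → (ℕ → ℕ) → X) (k : ℕ) (z : ℕ → ℕ) (i : ℕ) : Set X :=
  f i '' {y | ∀ m < k, m.unpair.1 = i → y m.unpair.2 = z m}

theorem codedImage_congr (f : ℕ → (ℕ → ℕ) → X) {k : ℕ} {z z' : ℕ → ℕ} (h : ∀ m < k, z m = z' m) :
    codedImage f k z = codedImage f k z' := by
  funext i
  unfold codedImage
  congr 1
  ext y
  exact forall_congr' fun m => forall_congr' fun hm => by rw [h m hm]

/-- Fixing coordinate `k` refines only the set with index `k.unpair.1`, which is the union of its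
pieces over the values `v`. If every choice of `v` were separable, the enlargements could be glued:
their union over `v` at that index, their intersection at all others. -/
theorem exists_not_separableSeq_codedImage_succ [MeasurableSpace X] (f : ℕ → (ℕ → ℕ) → X)
    (k : ℕ) (z : ℕ → ℕ) (h : ¬MeasurablySeparableSeq (codedImage f k z)) :
    ∃ v, ¬MeasurablySeparableSeq (codedImage f (k + 1) (Function.update z k v)) := by
  by_contra! hs
  choose B hBm hBC hB using hs
  refine h ⟨fun i => if i = k.unpair.1 then ⋃ v, B v i else ⋂ v, B v i, fun i => ?_,
    fun i => ?_, ?_⟩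
  · beta_reduce
    split_ifs
    · exact .iUnion fun v => hBm v i
    · exact .iInter fun v => hBm v i
  · rintro _ ⟨y, hy, rfl⟩
    beta_reduce
    split_ifs with hi
    · refine mem_iUnion.2 ⟨y k.unpair.2, hBC _ _ ⟨y, fun m hm hmi => ?_, rfl⟩⟩
      rcases Nat.lt_succ_iff_lt_or_eq.1 hm with hm | rfl
      · rw [Function.update_of_ne hm.ne]; exact hy m hm hmi
      · rw [Function.update_self]
    · refine mem_iInter.2 fun v => hBC _ _ ⟨y, fun m hm hmi => ?_, rfl⟩
      rcases Nat.lt_succ_iff_lt_or_eq.1 hm with hm | rfl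
      · rw [Function.update_of_ne hm.ne]; exact hy m hm hmi
      · exact absurd hmi.symm hi
  · refine eq_empty_of_forall_notMem fun x hx => ?_
    rw [mem_iInter] at hx
    have h0 := hx k.unpair.1
    rw [if_pos rfl] at h0
    obtain ⟨v, hv⟩ := mem_iUnion.1 h0
    have : x ∈ ⋂ i, B v i := by
      refine mem_iInter.2 fun i => ?_
      by_cases hi : i = k.unpair.1
      · rw [hi]; exact hv
      · have := hx i
        rw [if_neg hi] at this
        exact mem_iInter.1 this v
    rw [hB v] at this
    exact this

theorem exists_forall_not_separableSeq_codedImage [MeasurableSpace X] (f : ℕ → (ℕ → ℕ) → X)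
    (h : ¬MeasurablySeparableSeq fun i => range (f i)) :
    ∃ z, ∀ k, ¬MeasurablySeparableSeq (codedImage f k z) := by
  choose! v hv using exists_not_separableSeq_codedImage_succ f
  let s : ℕ → ℕ → ℕ := fun k => Nat.rec 0 (fun k z => Function.update z k (v k z)) k
  have hs (k : ℕ) : s (k + 1) = Function.update (s k) k (v k (s k)) := rfl
  have hns (k : ℕ) : ¬MeasurablySeparableSeq (codedImage f k (s k)) := by
    induction k with
    | zero => convert h using 3; simp [codedImage]
    | succ k ih => rw [hs]; exact hv k (s k) ih
  have hlt (m k : ℕ) (hmk : m < k) : s k m = s (m + 1) m := by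
    induction k, hmk using Nat.le_induction with
    | base => rfl
    | succ k hk ih => rw [hs, Function.update_of_ne (Nat.ne_of_lt hk), ih]
  refine ⟨fun m => s (m + 1) m, fun k => ?_⟩
  rw [← codedImage_congr f (fun m hm => hlt m k hm)]
  exact hns k

/-- By continuity some cylinder around the `i`-th row of `z` maps into `U`, and it involves finitely
many coordinates; `K` exceeds all their codes. -/
theorem exists_codedImage_subset [TopologicalSpace X] {f : ℕ → (ℕ → ℕ) → X} {i : ℕ}
    (hf : Continuous (f i)) (z : ℕ → ℕ) {U : Set X} (hU : IsOpen U)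
    (hz : f i (fun j => z (Nat.pair i j)) ∈ U) :
    ∃ K, ∀ k ≥ K, codedImage f k z i ⊆ U := by
  obtain ⟨_, ⟨x', n, rfl⟩, hmem, hsub⟩ :=
    (PiNat.isTopologicalBasis_cylinders (fun _ : ℕ => ℕ)).mem_nhds_iff.1
      ((hU.preimage hf).mem_nhds hz)
  refine ⟨(Finset.range n).sup (fun m => Nat.pair i m + 1), fun k hk => ?_⟩
  rintro _ ⟨y, hy, rfl⟩
  refine hsub fun m hm => ?_
  have h1 : Nat.pair i m + 1 ≤ k :=
    (Finset.le_sup (f := fun m => Nat.pair i m + 1) (Finset.mem_range.2 hm)).trans hk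
  have := hy (Nat.pair i m) h1 (by simp)
  rw [Nat.unpair_pair] at this
  rw [this]
  exact hmem m hm

/-- **Novikov's separation theorem**: analytic sets with empty intersection can be enlarged to
Borel sets with empty intersection. -/
theorem measurablySeparableSeq_of_analyticSet [TopologicalSpace X] [T2Space X]
    [MeasurableSpace X] [OpensMeasurableSpace X] {A : ℕ → Set X} (hA : ∀ n, AnalyticSet (A n))
    (h : ⋂ n, A n = ∅) : MeasurablySeparableSeq A := by
  by_cases hne : ∃ n, A n = ∅
  · obtain ⟨n, hn⟩ := hne
    refine ⟨fun i => if i = n then ∅ else univ, fun i => ?_, fun i => ?_, ?_⟩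
    · beta_reduce
      split_ifs <;> simp
    · beta_reduce
      split_ifs with hi <;> simp [hi, hn]
    · exact eq_empty_of_forall_notMem fun x hx => by simpa using mem_iInter.1 hx n
  have hf (n : ℕ) : ∃ f : (ℕ → ℕ) → X, Continuous f ∧ range f = A n := by
    have := hA n
    rw [AnalyticSet] at this
    exact this.resolve_left fun h0 => hne ⟨n, h0⟩
  choose f hfc hfr using hf
  by_contra hns
  rw [show A = fun i => range (f i) from funext fun i => (hfr i).symm] at hns
  obtain ⟨z, hz⟩ := exists_forall_not_separableSeq_codedImage f hns
  -- The coded images at `i` shrink towards `x i`. As the sets `A i` have no common point, two of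
  -- these points differ; disjoint neighbourhoods of them, and the whole space at the other indices,
  -- separate a late stage.
  let x : ℕ → X := fun i => f i fun j => z (Nat.pair i j)
  have hx (i : ℕ) : x i ∈ A i := hfr i ▸ mem_range_self _
  obtain ⟨i, hi⟩ : ∃ i, x i ≠ x 0 := by
    by_contra! hall
    have : x 0 ∈ ⋂ n, A n := mem_iInter.2 fun n => hall n ▸ hx n
    rw [h] at this
    exact this
  obtain ⟨U, V, hU, hV, hiU, h0V, hUV⟩ := t2_separation hi
  obtain ⟨K, hK⟩ := exists_codedImage_subset (hfc i) z hU hiU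
  obtain ⟨L, hL⟩ := exists_codedImage_subset (hfc 0) z hV h0V
  have hi0 : i ≠ 0 := fun h0 => hi (by rw [h0])
  refine hz (max K L) ⟨fun j => if j = i then U else if j = 0 then V else univ, fun j => ?_,
    fun j => ?_, ?_⟩
  · beta_reduce
    split_ifs
    exacts [hU.measurableSet, hV.measurableSet, MeasurableSet.univ]
  · beta_reduce
    split_ifs with h1 h2
    · rw [h1]; exact hK _ (le_max_left _ _)
    · rw [h2]; exact hL _ (le_max_right _ _)
    · exact subset_univ _
  · refine eq_empty_of_forall_notMem fun y hy => ?_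
    have h1 := mem_iInter.1 hy i
    have h2 := mem_iInter.1 hy 0
    rw [if_pos rfl] at h1
    rw [if_neg hi0.symm, if_pos rfl] at h2
    exact hUV.le_bot ⟨h1, h2⟩

/-- A standard Borel space is covered by countably many measurable sets on which a pointwise bounded
family of functions, measurable in the parameter, is uniformly bounded. -/
theorem exists_measurable_cover_bounded [MeasurableSpace X] [StandardBorelSpace X]
    {ρ : X × ℝ → ℝ≥0∞} (hρ : Measurable ρ) {S : Set ℝ} (hS : MeasurableSet S)
    (hb : ∀ x, ∃ C : ℕ, ∀ t ∈ S, ρ (x, t) ≤ C) :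
    ∃ B : ℕ → Set X, (∀ n, MeasurableSet (B n)) ∧ (∀ n, ∀ x ∈ B n, ∀ t ∈ S, ρ (x, t) ≤ n) ∧
      ⋃ n, B n = univ := by
  let := upgradeStandardBorel X
  -- The points where the bound `n` fails at some time form a projection, hence an analytic set.
  -- Pointwise boundedness says that these sets have empty intersection; complements of separating
  -- Borel sets form the cover.
  have hA (n : ℕ) : AnalyticSet (Prod.fst '' {p : X × ℝ | (n : ℝ≥0∞) < ρ p ∧ p.2 ∈ S}) :=
    MeasurableSet.analyticSet_image ((measurableSet_lt measurable_const hρ).inter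
      (measurable_snd hS)) measurable_fst
  obtain ⟨B, hBm, hBA, hB⟩ := measurablySeparableSeq_of_analyticSet hA (by
    refine eq_empty_of_forall_notMem fun x hx => ?_
    obtain ⟨C, hC⟩ := hb x
    obtain ⟨⟨x', t⟩, ⟨h1, h2⟩, rfl⟩ := mem_iInter.1 hx C
    exact (hC t h2).not_gt h1)
  refine ⟨fun n => (B n)ᶜ, fun n => (hBm n).compl, fun n x hx t ht => ?_, ?_⟩
  · by_contra! hlt
    exact hx (hBA n ⟨(x, t), ⟨hlt, ht⟩, rfl⟩)
  · rw [← compl_iInter, hB, compl_empty]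

end Novikov

end

/-! ### From a `Q`-function to a jump kernel. -/

section

/-- Cutting the parameter space according to the integer part of the total mass writes the kernel as
a countable sum of finite kernels. -/
theorem isSFiniteKernel_of_forall_isFiniteMeasure {α β : Type*} [MeasurableSpace α]
    [MeasurableSpace β] (κ : Kernel α β) (h : ∀ a, κ a univ ≠ ∞) : IsSFiniteKernel κ := by
  classical
  let S : ℕ → Set α := fun n => {a | (n : ℝ≥0∞) ≤ κ a univ ∧ κ a univ < n + 1}
  have hS (n : ℕ) : MeasurableSet (S n) :=
    (measurableSet_le measurable_const (κ.measurable_coe MeasurableSet.univ)).inter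
      (measurableSet_lt (κ.measurable_coe MeasurableSet.univ) measurable_const)
  have hfin (n : ℕ) : IsFiniteKernel (Kernel.piecewise (hS n) κ 0) := by
    refine ⟨⟨n + 1, by finiteness, fun a => ?_⟩⟩
    rw [Kernel.piecewise_apply]
    split_ifs with ha
    · exact ha.2.le
    · simp
  have : κ = Kernel.sum fun n => Kernel.piecewise (hS n) κ 0 := by
    ext a A hA
    rw [Kernel.sum_apply' _ _ hA]
    have hm : a ∈ S ⌊(κ a univ).toReal⌋₊ := by
      have h1 := Nat.floor_le (ENNReal.toReal_nonneg (a := κ a univ))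
      have h2 := Nat.lt_floor_add_one (κ a univ).toReal
      constructor
      · rw [← ENNReal.ofReal_toReal (h a), ← ENNReal.ofReal_natCast]
        exact ENNReal.ofReal_le_ofReal (by simpa [ENNReal.toReal_ofReal] using h1)
      · rw [← ENNReal.toReal_lt_toReal (h a) (by finiteness)]
        rw [ENNReal.toReal_add (by finiteness) (by finiteness)]
        simpa using h2
    rw [tsum_eq_single ⌊(κ a univ).toReal⌋₊, Kernel.piecewise_apply, if_pos hm]
    intro n hn
    rw [Kernel.piecewise_apply, if_neg]
    · simp
    · intro hn'
      have h1 : n < ⌊(κ a univ).toReal⌋₊ + 1 := by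
        have := hn'.1.trans_lt hm.2
        exact_mod_cast this
      have h2 : ⌊(κ a univ).toReal⌋₊ < n + 1 := by
        have := hm.1.trans_lt hn'.2
        exact_mod_cast this
      omega
  rw [this]
  infer_instance

variable {X : Type*} [MeasurableSpace X]

theorem measurableSet_timeSet (T₀ : ℝ) (T₁ : EReal) : MeasurableSet (timeSet T₀ T₁) :=
  (measurableSet_le measurable_const measurable_id).inter
    (measurableSet_lt measurable_coe_real_ereal measurable_const)

theorem measurableSet_timeAfter (u : ℝ) (T₁ : EReal) : MeasurableSet (timeAfter u T₁) :=
  (measurableSet_lt measurable_const measurable_id).inter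
    (measurableSet_lt measurable_coe_real_ereal measurable_const)

theorem mem_timeSet_of_le {T₀ : ℝ} {T₁ : EReal} {s t : ℝ} (hs : (s : EReal) < T₁) (h0 : T₀ ≤ t)
    (hts : t ≤ s) : t ∈ timeSet T₀ T₁ :=
  ⟨h0, (EReal.coe_le_coe_iff.2 hts).trans_lt hs⟩

section QFunction

variable {T₀ : ℝ} {T₁ : EReal} {q : X → ℝ → SignedMeasure X}

/-- Needed because the set `B \ {x}` varies with `x`. Rectangles reduce to the measurability of the
`Q`-function itself; a π-λ argument does the rest. -/
theorem IsConservativeQFunction.measurable_section (hq : IsConservativeQFunction T₀ T₁ q)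
    {D : Set (X × X)} (hD : MeasurableSet D) :
    Measurable fun p : X × timeSet T₀ T₁ => q p.1 p.2 (Prod.mk p.1 ⁻¹' D) := by
  induction D, hD using MeasurableSpace.induction_on_inter generateFrom_prod.symm
    isPiSystem_prod with
  | empty => simp
  | basic D hD =>
    obtain ⟨A, hA, B, hB, rfl⟩ := hD
    have : (fun p : X × timeSet T₀ T₁ => q p.1 p.2 (Prod.mk p.1 ⁻¹' A ×ˢ B))
        = (Prod.fst ⁻¹' A).indicator fun p : X × timeSet T₀ T₁ => q p.1 p.2 B := by
      ext p
      by_cases hp : p.1 ∈ A <;> simp [hp]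
    rw [this]
    exact (hq.measurable_eval B hB).indicator (measurable_fst hA)
  | compl D hD ih =>
    have : (fun p : X × timeSet T₀ T₁ => q p.1 p.2 (Prod.mk p.1 ⁻¹' Dᶜ))
        = fun p => q p.1 p.2 univ - q p.1 p.2 (Prod.mk p.1 ⁻¹' D) := by
      ext p
      rw [preimage_compl, compl_eq_univ_sdiff,
        ← VectorMeasure.of_add_of_sdiff (measurable_prodMk_left hD) MeasurableSet.univ
          (subset_univ _), add_sub_cancel_left]
    rw [this]
    exact (hq.measurable_eval univ MeasurableSet.univ).sub ih
  | iUnion f hd hf ih =>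
    refine measurable_of_tendsto_metrizable
      (f := fun n (p : X × timeSet T₀ T₁) =>
        ∑ i ∈ Finset.range n, q p.1 p.2 (Prod.mk p.1 ⁻¹' f i))
      (fun n => Finset.measurable_fun_sum _ fun i _ => ih i) (tendsto_pi_nhds.2 fun p => ?_)
    rw [preimage_iUnion]
    exact ((q p.1 p.2).m_iUnion (fun i => measurable_prodMk_left (hf i))
      fun i j hij => (hd hij).preimage _).tendsto_sum_nat

variable [StandardBorelSpace X]

theorem IsConservativeQFunction.measurable_off (hq : IsConservativeQFunction T₀ T₁ q)
    {B : Set X} (hB : MeasurableSet B) :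
    Measurable fun p : X × timeSet T₀ T₁ => q p.1 p.2 (B \ {p.1}) := by
  have hD : MeasurableSet {p : X × X | p.2 ∈ B ∧ p.2 ≠ p.1} :=
    (measurable_snd hB).inter (measurableSet_eq_fun measurable_snd measurable_fst).compl
  exact hq.measurable_section hD

open Classical in
/-- The jump kernel of a `Q`-function, extended by `0` outside of `[T₀, T₁[`. -/
noncomputable def jumpKernel (hq : IsConservativeQFunction T₀ T₁ q) : Kernel (X × ℝ) X where
  toFun p := if p.2 ∈ timeSet T₀ T₁ then jumpMeasure q p.1 p.2 else 0
  measurable' := by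
    refine Measure.measurable_of_measurable_coe _ fun B hB => ?_
    have hS : MeasurableSet {p : X × ℝ | p.2 ∈ timeSet T₀ T₁} :=
      measurable_snd (measurableSet_timeSet T₀ T₁)
    refine measurable_of_restrict_of_restrict_compl hS ?_ ?_
    · have h1 : Measurable fun p : {p : X × ℝ | p.2 ∈ timeSet T₀ T₁} =>
          ENNReal.ofReal (q p.1.1 p.1.2 (B \ {p.1.1})) :=
        ((hq.measurable_off hB).comp (g := fun p : X × timeSet T₀ T₁ => q p.1 p.2 (B \ {p.1}))
          (f := fun p : {p : X × ℝ | p.2 ∈ timeSet T₀ T₁} => (p.1.1, ⟨p.1.2, p.2⟩))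
          (by fun_prop)).ennreal_ofReal
      convert h1 using 2 with p
      have hp : p.1.2 ∈ timeSet T₀ T₁ := p.2
      simp only [domRestrict_apply, if_pos hp]
      exact jumpMeasure_apply hq _ hp hB
    · convert! measurable_const (a := (0 : ℝ≥0∞)) using 2 with p
      have hp : p.1.2 ∉ timeSet T₀ T₁ := p.2
      simp only [domRestrict_apply, if_neg hp]
      rfl

theorem jumpKernel_eq (hq : IsConservativeQFunction T₀ T₁ q) (x : X) {t : ℝ}
    (ht : t ∈ timeSet T₀ T₁) : jumpKernel hq (x, t) = jumpMeasure q x t := if_pos ht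

theorem jumpKernel_of_notMem (hq : IsConservativeQFunction T₀ T₁ q) (x : X) {t : ℝ}
    (ht : t ∉ timeSet T₀ T₁) : jumpKernel hq (x, t) = 0 := if_neg ht

theorem jumpKernel_apply (hq : IsConservativeQFunction T₀ T₁ q) (x : X) {t : ℝ}
    (ht : t ∈ timeSet T₀ T₁) {B : Set X} (hB : MeasurableSet B) :
    jumpKernel hq (x, t) B = ENNReal.ofReal (q x t (B \ {x})) := by
  rw [jumpKernel_eq hq x ht, jumpMeasure_apply hq x ht hB]

theorem toReal_jumpKernel_apply (hq : IsConservativeQFunction T₀ T₁ q) (x : X) {t : ℝ}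
    (ht : t ∈ timeSet T₀ T₁) {B : Set X} (hB : MeasurableSet B) :
    (jumpKernel hq (x, t) B).toReal = q x t (B \ {x}) := by
  rw [jumpKernel_apply hq x ht hB, ENNReal.toReal_ofReal (hq.nonneg_off x t ht B hB)]

omit [StandardBorelSpace X] in
theorem rate_nonneg (hq : IsConservativeQFunction T₀ T₁ q) (x : X) {t : ℝ}
    (ht : t ∈ timeSet T₀ T₁) : 0 ≤ rate q x t := hq.nonneg_off x t ht univ MeasurableSet.univ

theorem totalRate_jumpKernel (hq : IsConservativeQFunction T₀ T₁ q) (x : X) {t : ℝ}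
    (ht : t ∈ timeSet T₀ T₁) : totalRate (jumpKernel hq) (x, t) = ENNReal.ofReal (rate q x t) :=
  jumpKernel_apply hq x ht MeasurableSet.univ

theorem toReal_totalRate_jumpKernel (hq : IsConservativeQFunction T₀ T₁ q) (x : X) {t : ℝ}
    (ht : t ∈ timeSet T₀ T₁) : (totalRate (jumpKernel hq) (x, t)).toReal = rate q x t :=
  toReal_jumpKernel_apply hq x ht MeasurableSet.univ

theorem totalRate_jumpKernel_of_notMem (hq : IsConservativeQFunction T₀ T₁ q) (x : X) {t : ℝ}
    (ht : t ∉ timeSet T₀ T₁) : totalRate (jumpKernel hq) (x, t) = 0 := by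
  simp [totalRate, jumpKernel_of_notMem hq x ht]

instance (hq : IsConservativeQFunction T₀ T₁ q) : IsSFiniteKernel (jumpKernel hq) := by
  refine isSFiniteKernel_of_forall_isFiniteMeasure _ fun p => ?_
  by_cases hp : p.2 ∈ timeSet T₀ T₁
  · rw [jumpKernel_apply hq p.1 hp MeasurableSet.univ]; finiteness
  · rw [jumpKernel_of_notMem hq p.1 hp]; simp

theorem exists_totalRate_le (hq : IsConservativeQFunction T₀ T₁ q)
    (hb : LocallyBoundedRates T₀ T₁ q) {s : ℝ} (hs : s ∈ timeAfter T₀ T₁) (x : X) :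
    ∃ C : ℕ, ∀ t ∈ Iio s, totalRate (jumpKernel hq) (x, t) ≤ C := by
  obtain ⟨C, hC⟩ := hb s hs x
  obtain ⟨n, hn⟩ := exists_nat_ge C
  refine ⟨n, fun t ht => ?_⟩
  by_cases h0 : T₀ ≤ t
  · have hts := mem_timeSet_of_le hs.2 h0 (le_of_lt ht)
    rw [totalRate_jumpKernel hq x hts, ← ENNReal.ofReal_natCast]
    exact ENNReal.ofReal_le_ofReal ((hC ⟨t, ⟨h0, ht⟩, rfl⟩).trans hn)
  · rw [totalRate_jumpKernel_of_notMem hq x fun h => h0 h.1]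
    exact zero_le

theorem hasIntegrableRates_jumpKernel (hq : IsConservativeQFunction T₀ T₁ q)
    (hb : LocallyBoundedRates T₀ T₁ q) {s : ℝ} (hs : s ∈ timeAfter T₀ T₁) :
    HasIntegrableRates (jumpKernel hq) s := by
  intro x
  obtain ⟨C, hC⟩ := exists_totalRate_le hq hb hs x
  have : ∫⁻ θ in Iio s, totalRate (jumpKernel hq) (x, θ)
      ≤ ∫⁻ θ, (Ico T₀ s).indicator (fun _ => (C : ℝ≥0∞)) θ := by
    rw [← lintegral_indicator measurableSet_Iio]
    refine lintegral_mono fun t => ?_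
    by_cases ht : t ∈ Ico T₀ s
    · rw [indicator_of_mem (show t ∈ Iio s from ht.2), indicator_of_mem ht]
      exact hC t ht.2
    · rw [indicator_of_notMem ht]
      by_cases hts : t ∈ Iio s
      · rw [indicator_of_mem hts, totalRate_jumpKernel_of_notMem hq x fun h => ht ⟨h.1, hts⟩]
      · rw [indicator_of_notMem hts]
  refine ne_top_of_le_ne_top ?_ this
  rw [lintegral_indicator measurableSet_Ico, setLIntegral_const, Real.volume_Ico]
  finiteness

theorem survival_jumpKernel (hq : IsConservativeQFunction T₀ T₁ q)
    (hb : LocallyBoundedRates T₀ T₁ q) (x : X) {u t : ℝ} (hu : T₀ ≤ u) (hut : u < t)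
    (ht : (t : EReal) < T₁) :
    survival (jumpKernel hq) (x, u, t) = ENNReal.ofReal (Real.exp (-∫ s in u..t, rate q x s)) := by
  have hint := hasIntegrableRates_jumpKernel hq hb (s := t) ⟨hu.trans_lt hut, ht⟩ x
  rw [survival, surv_eq (by fun_prop) hut.le
    (ne_top_of_le_ne_top hint (lintegral_mono_set fun _ hw => hw.2))]
  congr 3
  refine intervalIntegral.integral_congr fun w hw => ?_
  rw [uIcc_of_le hut.le] at hw
  exact toReal_totalRate_jumpKernel hq x (mem_timeSet_of_le ht (hu.trans hw.1) hw.2)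

/-- Every jump time lies in `]u, t[`, inside `[T₀, T₁[`, so the extension of the jump kernel by zero
is never seen. -/
theorem fellerIter_eq_fellerKernel (hq : IsConservativeQFunction T₀ T₁ q)
    (hb : LocallyBoundedRates T₀ T₁ q) (n : ℕ) {u t : ℝ} (x : X) (hu : T₀ ≤ u) (hut : u < t)
    (ht : (t : EReal) < T₁) {B : Set X} (hB : MeasurableSet B) :
    fellerIter q n u x t B = fellerKernel (jumpKernel hq) n (u, x, t) B := by
  induction n generalizing u x with
  | zero =>
    rw [fellerKernel_zero_apply _ u x t hB, fellerIter]
    by_cases hx : x ∈ B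
    · rw [indicator_of_mem hx, indicator_of_mem hx, survival_jumpKernel hq hb x hu hut ht]
    · rw [indicator_of_notMem hx, indicator_of_notMem hx]
  | succ n ih =>
    rw [fellerKernel_succ_apply _ n u x t hB, fellerIter]
    refine setLIntegral_congr_fun measurableSet_Ioo fun w hw => ?_
    have hwt : (w : EReal) < T₁ := (EReal.coe_lt_coe_iff.2 hw.2).trans ht
    rw [jumpKernel_eq hq x ⟨hu.trans hw.1.le, hwt⟩, survival_jumpKernel hq hb x hu hw.1 hwt]
    refine lintegral_congr fun y => ?_
    rw [ih y (hu.trans hw.1.le) hw.2]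

theorem feller_eq_minimalKernel (hq : IsConservativeQFunction T₀ T₁ q)
    (hb : LocallyBoundedRates T₀ T₁ q) {u t : ℝ} (x : X) (hu : T₀ ≤ u) (hut : u < t)
    (ht : (t : EReal) < T₁) {B : Set X} (hB : MeasurableSet B) :
    feller q u x t B = minimalKernel (jumpKernel hq) (u, x, t) B := by
  rw [feller, minimalKernel, Kernel.sum_apply' _ _ hB]
  exact tsum_congr fun n => fellerIter_eq_fellerKernel hq hb n x hu hut ht hB

end QFunction

end

/-! ### Absolute continuity and integration of the forward equation. -/

section

section AbsolutelyContinuous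

variable {f : ℝ → ℝ} {u s : ℝ}

theorem absContOnIoo_of_absolutelyContinuousOnInterval {F : ℝ → ℝ}
    (hF : AbsolutelyContinuousOnInterval F u s) (hfF : EqOn f F (Ioo u s)) :
    AbsContOnIoo f u s := by
  intro ε hε
  obtain ⟨δ, hδ, h⟩ := (absolutelyContinuousOnInterval_iff F u s).1 hF ε hε
  refine ⟨δ, hδ, fun n a b hab hdisj hlen => ?_⟩
  have hm (i : ℕ) (hi : i < n) : a i ∈ Ioo u s ∧ b i ∈ Ioo u s := by
    obtain ⟨h1, h2, h3⟩ := hab i hi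
    exact ⟨⟨h1, h2.trans_lt h3⟩, ⟨h1.trans_le h2, h3⟩⟩
  have := h (n, fun i => (a i, b i)) ⟨fun i hi => ?_, fun i hi j hj hij => ?_⟩ ?_
  · refine lt_of_le_of_lt (Finset.sum_le_sum fun i hi => ?_) this
    obtain ⟨ha, hb⟩ := hm i (Finset.mem_range.1 hi)
    rw [dist_comm, Real.dist_eq, hfF ha, hfF hb]
  · obtain ⟨ha, hb⟩ := hm i (Finset.mem_range.1 hi)
    exact ⟨Ioo_subset_Icc_self.trans Icc_subset_uIcc ha,
      Ioo_subset_Icc_self.trans Icc_subset_uIcc hb⟩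
  · have hi' := Finset.mem_range.1 (Finset.mem_coe.1 hi)
    have hj' := Finset.mem_range.1 (Finset.mem_coe.1 hj)
    have := hdisj i hi' j hj' hij
    -- For open and for half-open real intervals, disjointness is the same inequality between end
    -- points.
    rw [Ioo_disjoint_Ioo] at this
    simp only [Function.onFun]
    rw [uIoc_of_le (hab i hi').2.1, uIoc_of_le (hab j hj').2.1, Ioc_disjoint_Ioc]
    exact this
  · refine lt_of_eq_of_lt (Finset.sum_congr rfl fun i hi => ?_) hlen
    rw [dist_comm, Real.dist_eq, abs_of_nonneg (sub_nonneg.2 (hab i (Finset.mem_range.1 hi)).2.1)]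

theorem AbsContOnIoo.absolutelyContinuousOnInterval (hf : AbsContOnIoo f u s) {a b : ℝ}
    (ha : u < a) (hab : a ≤ b) (hb : b < s) : AbsolutelyContinuousOnInterval f a b := by
  rw [absolutelyContinuousOnInterval_iff]
  intro ε hε
  obtain ⟨δ, hδ, h⟩ := hf ε hε
  refine ⟨δ, hδ, fun E hE hlen => ?_⟩
  have hdist (x y : ℝ) (g : ℝ → ℝ) : |g (max x y) - g (min x y)| = dist (g x) (g y) := by
    rcases le_total x y with hxy | hxy
    · rw [max_eq_right hxy, min_eq_left hxy, dist_comm, Real.dist_eq]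
    · rw [max_eq_left hxy, min_eq_right hxy, Real.dist_eq]
  -- The pairs in `E` are unordered, whereas `AbsContOnIoo` wants `a i ≤ b i`.
  have := h E.1 (fun i => min (E.2 i).1 (E.2 i).2) (fun i => max (E.2 i).1 (E.2 i).2)
    (fun i hi => ?_) (fun i hi j hj hij => ?_) ?_
  · simpa only [hdist _ _ f] using this
  · obtain ⟨h1, h2⟩ := hE.1 i (Finset.mem_range.2 hi)
    rw [uIcc_of_le hab] at h1 h2
    exact ⟨ha.trans_le (le_min h1.1 h2.1), min_le_max, (max_le h1.2 h2.2).trans_lt hb⟩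
  · exact (hE.2 (Finset.mem_coe.2 (Finset.mem_range.2 hi))
      (Finset.mem_coe.2 (Finset.mem_range.2 hj)) hij).mono Ioo_subset_Ioc_self Ioo_subset_Ioc_self
  · refine lt_of_eq_of_lt (Finset.sum_congr rfl fun i _ => ?_) hlen
    have := hdist (E.2 i).1 (E.2 i).2 id
    simp only [id] at this
    rw [abs_of_nonneg (sub_nonneg.2 min_le_max)] at this
    exact this

theorem tendsto_absCont_hasDerivAt_of_eq_integral {g : ℝ → ℝ} {c : ℝ} (hus : u < s)
    (hg : IntervalIntegrable g volume u s) (hf : ∀ t ∈ Ioo u s, f t = c + ∫ w in u..t, g w) :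
    Tendsto f (𝓝[>] u) (𝓝 c) ∧ AbsContOnIoo f u s ∧
      ∀ᵐ t ∂(volume.restrict (Ioo u s)), HasDerivAt f (g t) t := by
  have hac : AbsolutelyContinuousOnInterval (fun t => ∫ w in u..t, g w) u s :=
    hg.absolutelyContinuousOnInterval_intervalIntegral (by simp)
  refine ⟨?_, ?_, ?_⟩
  · have h1 := hac.continuousOn u left_mem_uIcc
    rw [uIcc_of_le hus.le, ContinuousWithinAt, intervalIntegral.integral_same] at h1
    have h2 : Tendsto (fun t => c + ∫ w in u..t, g w) (𝓝[>] u) (𝓝 (c + 0)) :=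
      tendsto_const_nhds.add (h1.mono_left (by
        rw [← nhdsWithin_Ioo_eq_nhdsGT hus]
        exact nhdsWithin_mono _ Ioo_subset_Icc_self))
    rw [add_zero] at h2
    refine h2.congr' ?_
    filter_upwards [Ioo_mem_nhdsGT hus] with t ht using (hf t ht).symm
  · have hz : AbsolutelyContinuousOnInterval (fun t => c + ∫ w in u..t, g w) u s := by
      unfold AbsolutelyContinuousOnInterval at hac ⊢
      simpa only [dist_add_left] using hac
    exact absContOnIoo_of_absolutelyContinuousOnInterval hz hf
  · rw [ae_restrict_iff' measurableSet_Ioo]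
    filter_upwards [hg.ae_hasDerivAt_integral] with t ht htm
    have h1 := ht (Ioo_subset_Icc_self.trans Icc_subset_uIcc htm) u left_mem_uIcc
    refine (h1.const_add c).congr_of_eventuallyEq ?_
    filter_upwards [Ioo_mem_nhds htm.1 htm.2] with r hr using hf r hr

variable {c : ℝ}

/-- Near `u` the limit gives the bound, and on the remaining compact interval absolute continuity
does. -/
theorem AbsContOnIoo.exists_bound (hf : AbsContOnIoo f u s) (hlim : Tendsto f (𝓝[>] u) (𝓝 c))
    {t : ℝ} (ht : t ∈ Ioo u s) : ∃ K : ℝ, ∀ w ∈ Ioc u t, f w ≤ K := by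
  have h1 : ∀ᶠ w in 𝓝[>] u, f w < c + 1 := hlim.eventually_lt_const (by linarith)
  obtain ⟨a, ha, hau⟩ := mem_nhdsGT_iff_exists_Ioo_subset.1 h1
  have hb : u < min a t := lt_min ha ht.1
  obtain ⟨b, hub, hb⟩ := exists_between hb
  obtain ⟨K, hK⟩ := (hf.absolutelyContinuousOnInterval hub
    (hb.le.trans (min_le_right _ _)) ht.2).exists_bound
  refine ⟨max (c + 1) K, fun w hw => ?_⟩
  rcases lt_or_ge w b with hwb | hwb
  · exact (hau ⟨hw.1, hwb.trans (hb.trans_le (min_le_left _ _))⟩).le.trans (le_max_left _ _)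
  · refine ((le_abs_self _).trans (hK w ?_)).trans (le_max_right _ _)
    exact Icc_subset_uIcc ⟨hwb, hw.2⟩

theorem tendsto_lintegral_Ioo {G : ℝ → ℝ≥0∞} {a : ℕ → ℝ} {t : ℝ} (ha : StrictAnti a)
    (hau : ∀ n, u < a n) (hlim : Tendsto a atTop (𝓝 u)) :
    Tendsto (fun n => ∫⁻ w in Ioo (a n) t, G w) atTop (𝓝 (∫⁻ w in Ioo u t, G w)) := by
  have hU : ⋃ n, Ioo (a n) t = Ioo u t := by
    ext w
    simp only [mem_iUnion, mem_Ioo]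
    constructor
    · rintro ⟨n, h1, h2⟩
      exact ⟨(hau n).trans h1, h2⟩
    · rintro ⟨h1, h2⟩
      obtain ⟨n, hn⟩ := (hlim.eventually_lt_const h1).exists
      exact ⟨n, hn, h2⟩
  have := tendsto_measure_iUnion_atTop (μ := volume.withDensity G)
    (s := fun n => Ioo (a n) t) fun m n hmn => Ioo_subset_Ioo_left (ha.antitone hmn)
  simpa only [hU, Function.comp_def, withDensity_apply _ measurableSet_Ioo] using this

/-- Integration of the equation `f' = G - H`, for `f ≥ 0` absolutely continuous and `H ≤ C f`. -/
theorem AbsContOnIoo.ofReal_add_lintegral {G H : ℝ → ℝ≥0∞} (hf : AbsContOnIoo f u s)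
    (hlim : Tendsto f (𝓝[>] u) (𝓝 c)) (hf0 : ∀ t, 0 ≤ f t) (hH : Measurable H)
    {C : ℝ≥0∞} (hC : C ≠ ∞) (hHf : ∀ t ∈ Ioo u s, H t ≤ C * ENNReal.ofReal (f t))
    (hd : ∀ᵐ t ∂(volume.restrict (Ioo u s)),
      G t ≠ ∞ ∧ HasDerivAt f ((G t).toReal - (H t).toReal) t) {t : ℝ} (ht : t ∈ Ioo u s) :
    ENNReal.ofReal (f t) + ∫⁻ w in Ioo u t, H w = ENNReal.ofReal c + ∫⁻ w in Ioo u t, G w := by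
  -- On `[a, t]`, away from the end point `u`, the fundamental theorem of calculus applies;
  -- afterwards `a` decreases to `u`.
  have key (a : ℝ) (ha : a ∈ Ioo u t) : ENNReal.ofReal (f t) + ∫⁻ w in Ioo a t, H w
      = ENNReal.ofReal (f a) + ∫⁻ w in Ioo a t, G w := by
    have hac := hf.absolutelyContinuousOnInterval ha.1 ha.2.le ht.2
    have hsub : Ioo a t ⊆ Ioo u s := Ioo_subset_Ioo ha.1.le ht.2.le
    have hd' : ∀ᵐ w ∂(volume.restrict (Ioo a t)),
        G w ≠ ∞ ∧ HasDerivAt f ((G w).toReal - (H w).toReal) w :=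
      ae_restrict_of_ae_restrict_of_subset hsub hd
    obtain ⟨K, hK⟩ := hf.exists_bound hlim ht
    have hHfin : ∫⁻ w in Ioo a t, H w ≠ ∞ := by
      refine ne_top_of_le_ne_top (b := ∫⁻ w in Ioo a t, C * ENNReal.ofReal K) ?_ ?_
      · rw [setLIntegral_const, Real.volume_Ioo]; finiteness
      · refine setLIntegral_mono' measurableSet_Ioo fun w hw => (hHf w (hsub hw)).trans ?_
        gcongr
        exact hK w ⟨ha.1.trans hw.1, hw.2.le⟩
    have hHi : IntegrableOn (fun w => (H w).toReal) (Ioo a t) :=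
      integrable_toReal_of_lintegral_ne_top hH.aemeasurable hHfin
    have hDi : IntegrableOn (deriv f) (Ioo a t) :=
      (intervalIntegrable_iff_integrableOn_Ioo_of_le ha.2.le).1 hac.intervalIntegrable_deriv
    have hDeq : deriv f =ᵐ[volume.restrict (Ioo a t)] fun w => (G w).toReal - (H w).toReal := by
      filter_upwards [hd'] with w hw using hw.2.deriv
    -- Nothing is assumed on the measurability or size of `G`; both come from `G = f' + H` almost
    -- everywhere.
    have hGi : IntegrableOn (fun w => (G w).toReal) (Ioo a t) := by
      refine (hDi.add hHi).congr ?_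
      filter_upwards [hDeq] with w hw
      simp [hw]
    have hI := hac.integral_deriv_eq_sub
    rw [intervalIntegral.integral_of_le ha.2.le, integral_Ioc_eq_integral_Ioo,
      integral_congr_ae hDeq, integral_sub hGi hHi] at hI
    have hGl : ∫⁻ w in Ioo a t, G w = ENNReal.ofReal (∫ w in Ioo a t, (G w).toReal) := by
      rw [ofReal_integral_eq_lintegral_ofReal hGi
        (Eventually.of_forall fun w => ENNReal.toReal_nonneg)]
      refine lintegral_congr_ae ?_
      filter_upwards [hd'] with w hw using (ENNReal.ofReal_toReal hw.1).symm
    have hHl : ∫⁻ w in Ioo a t, H w = ENNReal.ofReal (∫ w in Ioo a t, (H w).toReal) := by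
      rw [integral_toReal hH.aemeasurable (ae_lt_top hH hHfin), ENNReal.ofReal_toReal hHfin]
    rw [hGl, hHl, ← ENNReal.ofReal_add (hf0 _) (integral_nonneg fun w => ENNReal.toReal_nonneg),
      ← ENNReal.ofReal_add (hf0 _) (integral_nonneg fun w => ENNReal.toReal_nonneg)]
    congr 1
    linarith
  obtain ⟨a, ha, hat, hau⟩ := exists_seq_strictAnti_tendsto' ht.1
  have h1 := (tendsto_lintegral_Ioo (G := H) (t := t) ha (fun n => (hat n).1) hau).const_add
    (ENNReal.ofReal (f t))
  have h2 : Tendsto (fun n => ENNReal.ofReal (f (a n)) + ∫⁻ w in Ioo (a n) t, G w) atTop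
      (𝓝 (ENNReal.ofReal c + ∫⁻ w in Ioo u t, G w)) :=
    (ENNReal.tendsto_ofReal (hlim.comp (tendsto_nhdsWithin_iff.2
      ⟨hau, Eventually.of_forall fun n => (hat n).1⟩))).add
      (tendsto_lintegral_Ioo ha (fun n => (hat n).1) hau)
  exact tendsto_nhds_unique h1 (h2.congr fun n => (key (a n) (hat n)).symm)

end AbsolutelyContinuous

variable {X : Type*} [MeasurableSpace X]

/-- The mild equation can be checked locally. -/
theorem isMild_of_cover {e : X × ℝ × ℝ → ℝ≥0∞} (he : Measurable e) {u t : ℝ} {M ν : Kernel ℝ X}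
    [IsSFiniteKernel ν] {m : Measure X} {B : ℕ → Set X} (hBm : ∀ n, MeasurableSet (B n))
    (hB : ⋃ n, B n = univ)
    (h : ∀ n, ∀ A ⊆ B n, MeasurableSet A → M t A =
      ∫⁻ y in A, e (y, u, t) ∂m + ∫⁻ w in Ioo u t, ∫⁻ y in A, e (y, w, t) ∂ν w) :
    IsMild e u M ν m t := by
  have he' : Measurable (Function.uncurry fun w y => e (y, w, t)) := by
    unfold Function.uncurry; fun_prop
  -- The right side of the mild equation is itself a measure, so agreement on each piece of a
  -- countable cover suffices.
  let ρ : Measure X := m.withDensity (fun y => e (y, u, t)) +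
    (volume.restrict (Ioo u t)).bind (ν.withDensity fun w y => e (y, w, t))
  have hρ (A : Set X) (hA : MeasurableSet A) : ρ A = ∫⁻ y in A, e (y, u, t) ∂m
      + ∫⁻ w in Ioo u t, ∫⁻ y in A, e (y, w, t) ∂ν w := by
    simp only [ρ, Measure.add_apply, Measure.bind_apply hA (Kernel.measurable _).aemeasurable,
      withDensity_apply _ hA, Kernel.withDensity_apply' _ he']
  have : M t = ρ := by
    refine (Measure.ext_iff_of_iUnion_eq_univ hB).2 fun n => ?_
    ext A hA
    rw [Measure.restrict_apply hA, Measure.restrict_apply hA, hρ _ (hA.inter (hBm n))]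
    exact h n _ inter_subset_right (hA.inter (hBm n))
  intro A hA
  rw [this, hρ A hA]

end

/-! ### Existence and minimality for the forward equation. -/

section

variable {X : Type*} [MeasurableSpace X] [StandardBorelSpace X]
  {T₀ : ℝ} {T₁ : EReal} {q : X → ℝ → SignedMeasure X}

/-- Rates and jump probabilities are nonnegative and finite, so integrability is finiteness of the
`ℝ≥0∞`-valued integrals of the jump kernel. -/
theorem forwardEquationAt_iff (hq : IsConservativeQFunction T₀ T₁ q) {μ : ℝ → Measure X}
    {B : Set X} (hB : MeasurableSet B) {t : ℝ} (ht : t ∈ timeSet T₀ T₁) :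
    ForwardEquationAt q μ B t ↔ ∫⁻ y in B, totalRate (jumpKernel hq) (y, t) ∂μ t ≠ ∞ ∧
      ∫⁻ y, jumpKernel hq (y, t) B ∂μ t ≠ ∞ ∧
      HasDerivAt (fun r => (μ r).real B) ((∫⁻ y, jumpKernel hq (y, t) B ∂μ t).toReal
        - (∫⁻ y in B, totalRate (jumpKernel hq) (y, t) ∂μ t).toReal) t := by
  have hm1 : Measurable fun y => totalRate (jumpKernel hq) (y, t) := by fun_prop
  have hm2 : Measurable fun y => jumpKernel hq (y, t) B :=
    ((jumpKernel hq).measurable_coe hB).comp (by fun_prop)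
  have hf1 (y : X) : totalRate (jumpKernel hq) (y, t) < ∞ := by
    rw [totalRate_jumpKernel hq y ht]; finiteness
  have hf2 (y : X) : jumpKernel hq (y, t) B < ∞ := by
    rw [jumpKernel_apply hq y ht hB]; finiteness
  have h1 : (fun y => rate q y t) = fun y => (totalRate (jumpKernel hq) (y, t)).toReal :=
    funext fun y => (toReal_totalRate_jumpKernel hq y ht).symm
  have h2 : (fun y => q y t (B \ {y})) = fun y => (jumpKernel hq (y, t) B).toReal :=
    funext fun y => (toReal_jumpKernel_apply hq y ht hB).symm
  rw [ForwardEquationAt, h1, h2, IntegrableOn,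
    integrable_toReal_iff hm1.aemeasurable (Eventually.of_forall fun y => (hf1 y).ne),
    integrable_toReal_iff hm2.aemeasurable (Eventually.of_forall fun y => (hf2 y).ne),
    integral_toReal hm1.aemeasurable (Eventually.of_forall hf1),
    integral_toReal hm2.aemeasurable (Eventually.of_forall hf2), neg_add_eq_sub]

omit [StandardBorelSpace X] in
theorem IsQBounded.subset {s : ℝ} {A B : Set X} (hB : IsQBounded T₀ q s B) (hAB : A ⊆ B)
    (hA : MeasurableSet A) : IsQBounded T₀ q s A :=
  ⟨hA, hB.2.imp fun _ hC x hx => hC x (hAB hx)⟩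

theorem IsQBounded.exists_setLIntegral_totalRate_le (hq : IsConservativeQFunction T₀ T₁ q)
    {s : ℝ} {B : Set X} (hB : IsQBounded T₀ q s B) (hs : (s : EReal) < T₁) :
    ∃ C : ℝ≥0∞, C ≠ ∞ ∧ ∀ t ∈ Ico T₀ s, ∀ μ : Measure X,
      ∫⁻ y in B, totalRate (jumpKernel hq) (y, t) ∂μ ≤ C * μ B := by
  obtain ⟨hBm, C, hC⟩ := hB
  refine ⟨ENNReal.ofReal C, ENNReal.ofReal_ne_top, fun t ht μ => ?_⟩
  rw [← setLIntegral_const]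
  refine setLIntegral_mono' hBm fun y hy => ?_
  rw [totalRate_jumpKernel hq y (mem_timeSet_of_le hs ht.1 ht.2.le)]
  exact ENNReal.ofReal_le_ofReal ((le_abs_self _).trans (hC y hy t ht))

theorem exists_isQBounded_cover (hq : IsConservativeQFunction T₀ T₁ q)
    (hb : LocallyBoundedRates T₀ T₁ q) {s : ℝ} (hs : s ∈ timeAfter T₀ T₁) :
    ∃ B : ℕ → Set X, (∀ n, IsQBounded T₀ q s (B n)) ∧ ⋃ n, B n = univ := by
  obtain ⟨B, hBm, hBb, hB⟩ := exists_measurable_cover_bounded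
    (measurable_totalRate (jumpKernel hq)) measurableSet_Iio (exists_totalRate_le hq hb hs)
  refine ⟨B, fun n => ⟨hBm n, n, fun x hx t ht => ?_⟩, hB⟩
  have hts := mem_timeSet_of_le hs.2 ht.1 ht.2.le
  have := hBb n x hx t ht.2
  rw [totalRate_jumpKernel hq x hts, ← ENNReal.ofReal_natCast,
    ENNReal.ofReal_le_ofReal_iff (Nat.cast_nonneg n)] at this
  rwa [abs_of_nonneg (rate_nonneg hq x hts)]

section Existence

/-- The minimal solution. -/
noncomputable def minimalSolution (hq : IsConservativeQFunction T₀ T₁ q) (u : ℝ) (x : X) (t : ℝ) :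
    Measure X := minimalKernel (jumpKernel hq) (u, x, t)

theorem minimalSolution_le_one (hq : IsConservativeQFunction T₀ T₁ q)
    (hb : LocallyBoundedRates T₀ T₁ q) {u t : ℝ} (hu : T₀ ≤ u) (x : X) (ht : t ∈ timeAfter u T₁)
    (B : Set X) : minimalSolution hq u x t B ≤ 1 :=
  (measure_mono (subset_univ B)).trans <| minimalKernel_univ_le_one
    (hasIntegrableRates_jumpKernel hq hb ⟨hu.trans_lt ht.1, ht.2⟩) ht.1.le x

theorem minimalSolution_balanced (hq : IsConservativeQFunction T₀ T₁ q)
    (hb : LocallyBoundedRates T₀ T₁ q) {u t : ℝ} (hu : T₀ ≤ u) (x : X)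
    (ht : t ∈ timeAfter u T₁) {A : Set X} (hA : MeasurableSet A) :
    minimalSolution hq u x t A + ∫⁻ w in Ioo u t, ∫⁻ y in A, totalRate (jumpKernel hq) (y, w)
        ∂minimalSolution hq u x w
      = Measure.dirac x A
        + ∫⁻ w in Ioo u t, ∫⁻ y, jumpKernel hq (y, w) A ∂minimalSolution hq u x w := by
  have hint := hasIntegrableRates_jumpKernel hq hb (s := t) ⟨hu.trans_lt ht.1, ht.2⟩
  have := IsMild.balanced (measurable_totalRate (jumpKernel hq)) (measurable_survival _) ht.1
    (fun y v hv => hint.survival_left hv.2.le y)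
    (fun t _ => isMild_minimalFrom (jumpKernel hq) u x t) A hA
  simp only [jumpFlow_apply _ _ _ hA] at this
  exact this

theorem minimalSolution_bounded_set (hq : IsConservativeQFunction T₀ T₁ q)
    (hb : LocallyBoundedRates T₀ T₁ q) {u s : ℝ} (hu : T₀ ≤ u) (x : X) (hs : s ∈ timeAfter u T₁)
    {B : Set X} (hB : IsQBounded T₀ q s B) :
    (Tendsto (fun t => (minimalSolution hq u x t).real B) (𝓝[>] u)
        (𝓝 (B.indicator (fun _ => (1 : ℝ)) x)) ∧
      AbsContOnIoo (fun t => (minimalSolution hq u x t).real B) u s) ∧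
    ∀ᵐ t ∂(volume.restrict (Ioo u s)), ForwardEquationAt q (minimalSolution hq u x) B t := by
  let H : ℝ → ℝ≥0∞ := fun w =>
    ∫⁻ y in B, totalRate (jumpKernel hq) (y, w) ∂minimalSolution hq u x w
  let G : ℝ → ℝ≥0∞ := fun w => ∫⁻ y, jumpKernel hq (y, w) B ∂minimalSolution hq u x w
  have hHm : Measurable H := Measurable.setLIntegral_kernel_prod_right
    (κ := minimalFrom (jumpKernel hq) u x) (f := fun w y => totalRate (jumpKernel hq) (y, w))
    (by unfold Function.uncurry; fun_prop) hB.1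
  have hGm : Measurable G := by
    have := (jumpFlow (jumpKernel hq) (minimalFrom (jumpKernel hq) u x)).measurable_coe hB.1
    simp only [jumpFlow_apply _ _ _ hB.1] at this
    exact this
  obtain ⟨C, hC, hCB⟩ := hB.exists_setLIntegral_totalRate_le hq hs.2
  have hHfin : ∫⁻ w in Ioo u s, H w ≠ ∞ := by
    refine ne_top_of_le_ne_top (b := ∫⁻ w in Ioo u s, C) ?_ ?_
    · rw [setLIntegral_const, Real.volume_Ioo]; finiteness
    · refine setLIntegral_mono' measurableSet_Ioo fun w hw => ?_
      refine (hCB w ⟨hu.trans hw.1.le, hw.2⟩ _).trans (mul_le_of_le_one_right zero_le ?_)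
      exact minimalSolution_le_one hq hb hu x
        ⟨hw.1, (EReal.coe_lt_coe_iff.2 hw.2).trans hs.2⟩ B
  have hbal (t : ℝ) (ht : t ∈ Ioc u s) : minimalSolution hq u x t B + ∫⁻ w in Ioo u t, H w
      = Measure.dirac x B + ∫⁻ w in Ioo u t, G w :=
    minimalSolution_balanced hq hb hu x
      ⟨ht.1, (EReal.coe_le_coe_iff.2 ht.2).trans_lt hs.2⟩ hB.1
  have hfin (t : ℝ) (ht : t ∈ Ioc u s) : minimalSolution hq u x t B ≠ ∞ :=
    ne_top_of_le_ne_top ENNReal.one_ne_top (minimalSolution_le_one hq hb hu x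
      ⟨ht.1, (EReal.coe_le_coe_iff.2 ht.2).trans_lt hs.2⟩ B)
  -- The inflow has no a priori bound, as jumps may come from regions with unbounded rates; the
  -- balance bounds it by present mass plus outflow.
  have hGfin : ∫⁻ w in Ioo u s, G w ≠ ∞ := by
    refine ne_top_of_le_ne_top ?_ (le_add_self (a := ∫⁻ w in Ioo u s, G w)
      (b := Measure.dirac x B))
    rw [← hbal s ⟨hs.1, le_rfl⟩]
    exact ENNReal.add_ne_top.2 ⟨hfin s ⟨hs.1, le_rfl⟩, hHfin⟩
  have hGi := intervalIntegrable_toReal hGm hs.1.le hGfin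
  have hHi := intervalIntegrable_toReal hHm hs.1.le hHfin
  have heq (t : ℝ) (ht : t ∈ Ioo u s) : (minimalSolution hq u x t).real B
      = B.indicator (fun _ => (1 : ℝ)) x + ∫ w in u..t, ((G w).toReal - (H w).toReal) := by
    have ht' : Ioo u t ⊆ Ioo u s := Ioo_subset_Ioo_right ht.2.le
    have hu' : uIcc u t ⊆ uIcc u s := by
      rw [uIcc_of_le ht.1.le, uIcc_of_le hs.1.le]
      exact Icc_subset_Icc_right ht.2.le
    have hGt := ne_top_of_le_ne_top hGfin (lintegral_mono_set ht')
    have hHt := ne_top_of_le_ne_top hHfin (lintegral_mono_set ht')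
    have h1 := congrArg ENNReal.toReal (hbal t ⟨ht.1, ht.2.le⟩)
    rw [ENNReal.toReal_add (hfin t ⟨ht.1, ht.2.le⟩) hHt, ENNReal.toReal_add (by finiteness) hGt,
      toReal_lintegral_Ioo hGm ht.1.le hGt, toReal_lintegral_Ioo hHm ht.1.le hHt] at h1
    rw [intervalIntegral.integral_sub (hGi.mono_set hu') (hHi.mono_set hu'), measureReal_def]
    have h2 : (Measure.dirac x B).toReal = B.indicator (fun _ => (1 : ℝ)) x := by
      rw [Measure.dirac_apply' x hB.1]
      by_cases hx : x ∈ B <;> simp [hx]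
    linarith
  obtain ⟨h1, h2, h3⟩ := tendsto_absCont_hasDerivAt_of_eq_integral hs.1 (hGi.sub hHi) heq
  refine ⟨⟨h1, h2⟩, ?_⟩
  filter_upwards [h3, ae_lt_top hGm hGfin, ae_lt_top hHm hHfin, ae_restrict_mem measurableSet_Ioo]
    with t ht hGt hHt htm
  exact (forwardEquationAt_iff hq hB.1
    (mem_timeSet_of_le hs.2 (hu.trans htm.1.le) htm.2.le)).2 ⟨hHt.ne, hGt.ne, ht⟩

theorem isForwardSolution_minimalSolution (hq : IsConservativeQFunction T₀ T₁ q)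
    (hb : LocallyBoundedRates T₀ T₁ q) : IsForwardSolution T₀ T₁ q (minimalSolution hq) where
  mem :=
    { finite := fun _ hu x _ ht =>
        ⟨(minimalSolution_le_one hq hb hu.1 x ht univ).trans_lt ENNReal.one_lt_top⟩
      measurable_time := fun u _ x _ hB =>
        ((minimalFrom (jumpKernel hq) u x).measurable_coe hB).comp measurable_subtype_coe }
  boundary := fun _ hu _ hs x _ hB => (minimalSolution_bounded_set hq hb hu.1 x hs hB).1
  forward := fun _ hu _ hs x _ hB => (minimalSolution_bounded_set hq hb hu.1 x hs hB).2

end Existence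

section Minimality

open Classical in
/-- A function of the class `𝒫̂` as a kernel in its terminal time, extended by `0`. -/
noncomputable def InPHat.kernel {P : ℝ → X → ℝ → Measure X} (hP : InPHat T₀ T₁ P) {u : ℝ}
    (hu : u ∈ timeSet T₀ T₁) (x : X) : Kernel ℝ X where
  toFun t := if t ∈ timeAfter u T₁ then P u x t else 0
  measurable' := by
    refine Measure.measurable_of_measurable_coe _ fun B hB => ?_
    refine measurable_of_restrict_of_restrict_compl (measurableSet_timeAfter u T₁) ?_ ?_
    · convert hP.measurable_time u hu x B hB using 2 with t
      simp only [domRestrict_apply, if_pos t.2]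
    · convert! measurable_const (a := (0 : ℝ≥0∞)) using 2 with t
      have ht : (t : ℝ) ∉ timeAfter u T₁ := t.2
      simp only [domRestrict_apply, if_neg ht]
      rfl

variable {P : ℝ → X → ℝ → Measure X} {u : ℝ}

omit [StandardBorelSpace X] in
theorem InPHat.kernel_apply (hP : InPHat T₀ T₁ P) (hu : u ∈ timeSet T₀ T₁) (x : X) {t : ℝ}
    (ht : t ∈ timeAfter u T₁) : hP.kernel hu x t = P u x t := if_pos ht

instance (hP : InPHat T₀ T₁ P) (hu : u ∈ timeSet T₀ T₁) (x : X) :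
    IsSFiniteKernel (hP.kernel hu x) := by
  refine isSFiniteKernel_of_forall_isFiniteMeasure _ fun t => ?_
  by_cases ht : t ∈ timeAfter u T₁
  · have := hP.finite u hu x t ht
    rw [hP.kernel_apply hu x ht]
    finiteness
  · have : hP.kernel hu x t = 0 := if_neg ht
    simp [this]

/-- The forward equation is integrated from `u` by `AbsContOnIoo.ofReal_add_lintegral`. Boundedness
of the rates on `B` controls the outflow by the mass of `B`, which stays bounded up to time `t`. -/
theorem IsForwardSolution.balanced (hq : IsConservativeQFunction T₀ T₁ q)
    (hP : IsForwardSolution T₀ T₁ q P) (hu : u ∈ timeSet T₀ T₁) (x : X) {s : ℝ}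
    (hs : s ∈ timeAfter u T₁) {B : Set X} (hB : IsQBounded T₀ q s B) {t : ℝ} (ht : t ∈ Ioo u s) :
    hP.mem.kernel hu x t B
        + ∫⁻ w in Ioo u t, ∫⁻ y in B, totalRate (jumpKernel hq) (y, w) ∂hP.mem.kernel hu x w
      = Measure.dirac x B
        + ∫⁻ w in Ioo u t, jumpFlow (jumpKernel hq) (hP.mem.kernel hu x) w B ∧
    ∫⁻ w in Ioo u t, ∫⁻ y in B, totalRate (jumpKernel hq) (y, w) ∂hP.mem.kernel hu x w ≠ ∞ := by
  obtain ⟨C, hC, hCB⟩ := hB.exists_setLIntegral_totalRate_le hq hs.2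
  obtain ⟨hlim, hac⟩ := hP.boundary u hu s hs x B hB
  have hafter (w : ℝ) (hw : w ∈ Ioo u s) : w ∈ timeAfter u T₁ :=
    ⟨hw.1, (EReal.coe_lt_coe_iff.2 hw.2).trans hs.2⟩
  have hreal (w : ℝ) (hw : w ∈ Ioo u s) :
      ENNReal.ofReal ((P u x w).real B) = hP.mem.kernel hu x w B := by
    have := hP.mem.finite u hu x w (hafter w hw)
    rw [hP.mem.kernel_apply hu x (hafter w hw), ofReal_measureReal]
  have hHm : Measurable fun w =>
      ∫⁻ y in B, totalRate (jumpKernel hq) (y, w) ∂hP.mem.kernel hu x w :=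
    Measurable.setLIntegral_kernel_prod_right (by unfold Function.uncurry; fun_prop) hB.1
  have hHle (w : ℝ) (hw : w ∈ Ioo u s) :
      ∫⁻ y in B, totalRate (jumpKernel hq) (y, w) ∂hP.mem.kernel hu x w
        ≤ C * ENNReal.ofReal ((P u x w).real B) := by
    rw [hreal w hw]
    exact hCB w ⟨hu.1.trans hw.1.le, hw.2⟩ _
  constructor
  · have := hac.ofReal_add_lintegral hlim (fun _ => measureReal_nonneg)
      (G := fun w => jumpFlow (jumpKernel hq) (hP.mem.kernel hu x) w B) hHm hC hHle ?_ ht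
    · rw [hreal t ht] at this
      rw [this, Measure.dirac_apply' x hB.1]
      congr 1
      by_cases hx : x ∈ B <;> simp [hx]
    · filter_upwards [hP.forward u hu s hs x B hB, ae_restrict_mem measurableSet_Ioo] with w hw hwm
      rw [jumpFlow_apply _ _ _ hB.1, hP.mem.kernel_apply hu x (hafter w hwm)]
      exact ((forwardEquationAt_iff hq hB.1
        (mem_timeSet_of_le hs.2 (hu.1.trans hwm.1.le) hwm.2.le)).1 hw).2
  · obtain ⟨K, hK⟩ := hac.exists_bound hlim ht
    refine ne_top_of_le_ne_top (b := ∫⁻ w in Ioo u t, C * ENNReal.ofReal K) ?_ ?_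
    · rw [setLIntegral_const, Real.volume_Ioo]; finiteness
    · refine setLIntegral_mono' measurableSet_Ioo fun w hw =>
        (hHle w ⟨hw.1, hw.2.trans ht.2⟩).trans ?_
      gcongr
      exact hK w ⟨hw.1, hw.2.le⟩

theorem IsForwardSolution.isMild (hq : IsConservativeQFunction T₀ T₁ q)
    (hb : LocallyBoundedRates T₀ T₁ q) (hP : IsForwardSolution T₀ T₁ q P)
    (hu : u ∈ timeSet T₀ T₁) (x : X) {t : ℝ} (ht : t ∈ timeAfter u T₁) :
    IsMild (survival (jumpKernel hq)) u (hP.mem.kernel hu x)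
      (jumpFlow (jumpKernel hq) (hP.mem.kernel hu x)) (Measure.dirac x) t := by
  -- The `(q, s)`-bounded sets carry information only at times before `s`, so `s` is taken strictly
  -- between `t` and `T₁`.
  obtain ⟨s, hts, hs⟩ := EReal.lt_iff_exists_real_btwn.1 ht.2
  rw [EReal.coe_lt_coe_iff] at hts
  have hus : s ∈ timeAfter u T₁ := ⟨ht.1.trans hts, hs⟩
  have hint := hasIntegrableRates_jumpKernel hq hb (s := t) ⟨hu.1.trans_lt ht.1, ht.2⟩
  obtain ⟨B, hBq, hB⟩ := exists_isQBounded_cover hq hb (s := s) ⟨hu.1.trans_lt hus.1, hs⟩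
  refine isMild_of_cover (measurable_survival _) (fun n => (hBq n).1) hB fun n A hAB hA => ?_
  refine mild_of_balanced_subsets (measurable_totalRate (jumpKernel hq)) (measurable_survival _)
    ht.1 (fun y v hv => hint.survival_right hv.2.le y) hA (fun r hr A' hA' hA'm => ?_) ?_
  · exact (hP.balanced hq hu x hus ((hBq n).subset (hA'.trans hAB) hA'm)
      ⟨hr.1, hr.2.trans_lt hts⟩).1
  · exact (hP.balanced hq hu x hus ((hBq n).subset hAB hA) ⟨ht.1, hts⟩).2

theorem minimalSolution_le (hq : IsConservativeQFunction T₀ T₁ q)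
    (hb : LocallyBoundedRates T₀ T₁ q) (hP : IsForwardSolution T₀ T₁ q P)
    (hu : u ∈ timeSet T₀ T₁) (x : X) {t : ℝ} (ht : t ∈ timeAfter u T₁) :
    minimalSolution hq u x t ≤ P u x t := by
  have := minimalFrom_le_of_isMild (jumpKernel hq) (u := u) (T := t) (x := x)
    (M := hP.mem.kernel hu x) (fun r hr => hP.isMild hq hb hu x
      ⟨hr.1, (EReal.coe_le_coe_iff.2 hr.2).trans_lt ht.2⟩) ⟨ht.1, le_rfl⟩
  rwa [hP.mem.kernel_apply hu x ht] at this

end Minimality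

end

end JumpMarkov

theorem theorem3p2 {X : Type*} [MeasurableSpace X] [StandardBorelSpace X]
    (T₀ : ℝ) (T₁ : EReal) (hT : (T₀ : EReal) < T₁)
    (q : X → ℝ → SignedMeasure X) (hq : JumpMarkov.IsConservativeQFunction T₀ T₁ q)
    (hALB : JumpMarkov.LocallyBoundedRates T₀ T₁ q) :
    ∃ Pbar : ℝ → X → ℝ → Measure X,
      (∀ u ∈ JumpMarkov.timeSet T₀ T₁, ∀ x, ∀ t ∈ JumpMarkov.timeAfter u T₁,
        ∀ B, MeasurableSet B → Pbar u x t B = JumpMarkov.feller q u x t B) ∧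
      JumpMarkov.IsForwardSolution T₀ T₁ q Pbar ∧
      (∀ P : ℝ → X → ℝ → Measure X, JumpMarkov.IsForwardSolution T₀ T₁ q P →
        ∀ u ∈ JumpMarkov.timeSet T₀ T₁, ∀ x, ∀ t ∈ JumpMarkov.timeAfter u T₁,
          ∀ B, MeasurableSet B → Pbar u x t B ≤ P u x t B) ∧
      (JumpMarkov.IsRegular T₀ T₁ Pbar →
        JumpMarkov.UnitValued T₀ T₁ Pbar ∧
        ∀ P : ℝ → X → ℝ → Measure X, JumpMarkov.IsForwardSolution T₀ T₁ q P →
          JumpMarkov.UnitValued T₀ T₁ P →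
          ∀ u ∈ JumpMarkov.timeSet T₀ T₁, ∀ x, ∀ t ∈ JumpMarkov.timeAfter u T₁,
            ∀ B, MeasurableSet B → P u x t B = Pbar u x t B) := by
  have hsol := JumpMarkov.isForwardSolution_minimalSolution hq hALB
  refine ⟨JumpMarkov.minimalSolution hq, fun u hu x t ht B hB =>
    (JumpMarkov.feller_eq_minimalKernel hq hALB x hu.1 ht.1 ht.2 hB).symm, hsol,
    fun P hP u hu x t ht B _ => JumpMarkov.minimalSolution_le hq hALB hP hu x ht B,
    fun hreg => ⟨fun u hu x t ht B _ => JumpMarkov.minimalSolution_le_one hq hALB hu.1 x ht B,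
      fun P hP hP1 u hu x t ht B _ => ?_⟩⟩
  have := hsol.mem.finite u hu x t ht
  -- A finite measure dominated by another of the same total mass equals it; regularity and the
  -- bound by one on `P` make the masses equal.
  have hle := JumpMarkov.minimalSolution_le hq hALB hP hu x ht
  rw [Measure.eq_of_le_of_measure_univ_eq hle (le_antisymm (hle univ)
    ((hP1 u hu x t ht univ MeasurableSet.univ).trans_eq (hreg u hu x t ht).symm))]
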